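/- Let $X$ be a real vector space with a symplectic form $\sigma$ (alternating bilinear; nondegeneracy is not needed). Let $\overline{\Delta(X,\sigma)}$ be the Weyl algebra, i.e. the C*-algebra generated by unitaries $\delta_f$ ($f\in X$) with $\delta_f^*=\delta_{-f}$, $\delta_f\delta_g=e^{-i\sigma(f,g)/2}\delta_{f+g}$. Call a state $\omega$ on it strongly regular if $(\lambda_1,\dots,\lambda_n)\mapsto\omega(\delta_{\lambda_1f_1}\cdots\delta_{\lambda_nf_n})$ is smooth on $\mathbb R^n$ for all $n$ and $f_1,\dots,f_n\in X$, and let $\pi_S$ be the direct sum of the GNS representations of all strongly regular states. For $f\in X\setminus0$ put $R(\lambda,f):=-i\int_0^\infty e^{-\lambda t}\pi_S(\delta_{-tf})\,dt$ (strong integral) if $\lambda>0$ and $R(\lambda,f):=R(-\lambda,f)^*$ if $\lambda<0$. The resolvent algebra $\mathcal R(X,\sigma)$ is the C*-algebra generated by $\mathbb 1$ and all $R(\lambda,f)$, $\lambda\in\mathbb R\setminus0$, $f\in X\setminus0$. For $z\in\mathbb C$ with $\operatorname{Re}z\neq0$ put $R(z,f):=\sum_{n\ge0}(\mu-z)^n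 i^n R(\mu,f)^{n+1}$ for any real $\mu$ with $|z-\mu|<|\mu|$ (the series converges and does not depend on $\mu$). Let $\pi$ be a representation of $\mathcal R(X,\sigma)$ on a complex Hilbert space $\mathcal H$. If $g\ne0$ and $\pi(R(1,g))$ is injective, put $j_\pi(g):=i\mathbb 1-\pi(R(1,g))^{-1}$ with domain $\operatorname{Ran}\pi(R(1,g))$; put $j_\pi(0):=0$. **Theorem.** Let $f,h\in X\setminus0$ with $\operatorname{Ker}\pi(R(1,f))=\{0\}=\operatorname{Ker}\pi(R(1,h))$. Then, with $\lambda$ real and $\lambda\neq0$ wherever $R(\lambda,\cdot)$ occurs: (i) $j_\pi(f)$ is selfadjoint, and $\pi(R(\lambda,f))\operatorname{Dom}j_\pi(h)\subseteq\operatorname{Dom}j_\pi(h)$. (ii) $\lim_{\lambda\to\infty}i\lambda\,\pi(R(\lambda,f))\psi=\psi$ for all $\psi\in\mathcal H$. (iii) $\lim_{s\to0,\,s\ne0}i\,\pi(R(1,sf))\psi=\psi$ for all $\psi\in\mathcal H$. (iv) $\mathcal D:=\pi(R(1,f)R(1,h))\mathcal H$ is dense and contained in $\operatorname{Dom}j_\pi(f)\cap\operatorname{Dom}j_\pi(h)$;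 $j_\pi(h)\mathcal D\subseteq\operatorname{Dom}j_\pi(f)$, $j_\pi(f)\mathcal D\subseteq\operatorname{Dom}j_\pi(h)$, and $[j_\pi(f),j_\pi(h)]=i\sigma(f,h)$ on $\mathcal D$. (v) For all $\lambda\in\mathbb R$: if $\lambda f+h\neq0$ then $\operatorname{Ker}\pi(R(1,\lambda f+h))=\{0\}$; and $\mathcal D\subseteq\operatorname{Dom}j_\pi(\lambda f+h)$ with $j_\pi(\lambda f+h)=\lambda j_\pi(f)+j_\pi(h)$ on $\mathcal D$. (vi) $j_\pi(f)\pi(R(\lambda,f))=\pi(R(\lambda,f))j_\pi(f)=i\lambda\,\pi(R(\lambda,f))-\mathbb 1$ on $\operatorname{Dom}j_\pi(f)$. (vii) $[j_\pi(f),\pi(R(\lambda,h))]=i\sigma(f,h)\,\pi(R(\lambda,h)^2)$ on $\operatorname{Dom}j_\pi(f)$, where $\pi(R(\lambda,h))$ maps $\operatorname{Dom}j_\pi(f)$ into itself. (viii) $j_\pi(f)$ and $j_\pi(h)$ each generate a unique strongly continuous one-parameter unitary group $t\mapsto e^{itj_\pi(\cdot)}$. With $W(f):=\exp(ij_\pi(f))$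 and $W(h):=\exp(ij_\pi(h))$, $$W(f)W(h)=e^{-i\sigma(f,h)}W(h)W(f),\qquad W(f)\,\pi(R(\lambda,h))\,W(f)^*=\pi\big(R(\lambda+i\sigma(h,f),\,h)\big).$$ Moreover $W(f)\mathcal D\subseteq\mathcal D$, $W(h)\mathcal D\subseteq\mathcal D$, and $\mathcal D$ is a common core for $j_\pi(f)$ and $j_\pi(h)$. -/

import Mathlib

open scoped InnerProductSpace ComplexOrder

/-- A symplectic form on a real vector space `X`: an alternating bilinear form `σ`.
Nondegeneracy is not imposed; nondegenerate forms are a special case. -/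
structure SymplecticForm (X : Type*) [AddCommGroup X] [Module ℝ X] where
  form : LinearMap.BilinForm ℝ X
  alt : form.IsAlt

namespace ResolventAlgebra

noncomputable section

section Weyl

variable {X : Type*} [AddCommGroup X] [Module ℝ X] (σ : SymplecticForm X)

/-- The phase `exp(-iσ(f,g)/2)`. -/
def phase (f g : X) : ℂ := Complex.exp (-(Complex.I * (σ.form f g : ℂ) / 2))

lemma norm_phase (f g : X) : ‖phase σ f g‖ = 1 := by
  have : -(Complex.I * (σ.form f g : ℂ) / 2) = ((-(σ.form f g) / 2 : ℝ) : ℂ) * Complex.I := by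
    push_cast; ring
  rw [phase, this, Complex.norm_exp_ofReal_mul_I]

lemma hasSum_weyl (f : X) (ξ : lp (fun _ : X => ℂ) 2) :
    HasSum (fun g => ‖phase σ f g * ξ (g - f)‖ ^ (2 : ENNReal).toReal)
      (‖ξ‖ ^ (2 : ENNReal).toReal) := by
  have h := lp.hasSum_norm (p := 2) (by norm_num) ξ
  have h' := (Equiv.subRight f).hasSum_iff.mpr h
  convert h' using 2 with g
  simp [norm_phase]

/-- The twisted translation `(δ_f ξ)(g) = exp(-iσ(f,g)/2) ξ(g - f)` on `ℓ²(X)`. -/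
def weylOp (f : X) : lp (fun _ : X => ℂ) 2 →L[ℂ] lp (fun _ : X => ℂ) 2 :=
  LinearMap.mkContinuous
    { toFun := fun ξ => ⟨fun g => phase σ f g * ξ (g - f), memℓp_gen (hasSum_weyl σ f ξ).summable⟩
      map_add' := fun ξ η => by
        ext g
        exact mul_add _ _ _
      map_smul' := fun c ξ => by
        ext g
        simp [mul_left_comm] }
    1 (fun ξ => by
      rw [one_mul]
      exact lp.norm_le_of_tsum_le (by norm_num) (norm_nonneg _) (hasSum_weyl σ f ξ).tsum_eq.le)

@[simp] lemma weylOp_apply (f g : X) (ξ : lp (fun _ : X => ℂ) 2) :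
    weylOp σ f ξ g = phase σ f g * ξ (g - f) := rfl

lemma form_swap (f g : X) : σ.form g f = -σ.form f g := by
  rw [LinearMap.IsAlt.neg σ.alt f g]

lemma weylOp_zero : weylOp σ 0 = 1 := by
  ext ξ g
  simp [phase]

/-- The Weyl relations `δ_f δ_g = exp(-iσ(f,g)/2) δ_{f+g}`. -/
lemma weylOp_mul (f g : X) : weylOp σ f * weylOp σ g = phase σ f g • weylOp σ (f + g) := by
  ext ξ x
  have h : phase σ f x * phase σ g (x - f) = phase σ f g * phase σ (f + g) x := by
    simp only [phase, ← Complex.exp_add]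
    congr 1
    have := form_swap σ f g
    simp only [map_sub, map_add, LinearMap.add_apply, this]
    push_cast
    ring
  simp only [mul_apply_eq_comp, weylOp_apply, _root_.smul_apply,
    lp.coeFn_smul, Pi.smul_apply, smul_eq_mul]
  rw [← mul_assoc, h, mul_assoc, sub_sub]

lemma weylOp_neg_mul (f : X) : weylOp σ (-f) * weylOp σ f = 1 := by
  rw [weylOp_mul]
  have : σ.form f f = 0 := σ.alt f
  simp [phase, this, weylOp_zero]

lemma norm_weylOp_apply (f : X) (ξ : lp (fun _ : X => ℂ) 2) : ‖weylOp σ f ξ‖ = ‖ξ‖ := by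
  have h := (lp.hasSum_norm (p := 2) (by norm_num) (weylOp σ f ξ)).unique (hasSum_weyl σ f ξ)
  simpa using h

lemma star_weylOp (f : X) : star (weylOp σ f) = weylOp σ (-f) := by
  have h1 : star (weylOp σ f) * weylOp σ f = 1 := by
    have := (ContinuousLinearMap.norm_map_iff_adjoint_comp_self (weylOp σ f)).mp
      (norm_weylOp_apply σ f)
    exact this
  have h2 : weylOp σ f * weylOp σ (-f) = 1 := by
    simpa using weylOp_neg_mul σ (-f)
  calc star (weylOp σ f) = star (weylOp σ f) * (weylOp σ f * weylOp σ (-f)) := by rw [h2, mul_one]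
    _ = weylOp σ (-f) := by rw [← mul_assoc, h1, one_mul]

/-- The C⋆-algebra generated by the unitaries `δ_f` of `ℓ²(X)`. -/
def weylSubalgebra : StarSubalgebra ℂ (lp (fun _ : X => ℂ) 2 →L[ℂ] lp (fun _ : X => ℂ) 2) :=
  (StarAlgebra.adjoin ℂ (Set.range (weylOp σ))).topologicalClosure

instance : IsClosed (weylSubalgebra σ :
    Set (lp (fun _ : X => ℂ) 2 →L[ℂ] lp (fun _ : X => ℂ) 2)) :=
  StarSubalgebra.isClosed_topologicalClosure _

/-- The Weyl algebra of `(X, σ)`: the C⋆-algebra generated by unitaries `δ_f`, `f ∈ X`, with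
`δ_f⋆ = δ_{-f}` and `δ_f δ_g = exp(-iσ(f,g)/2) δ_{f+g}`. It is realized on `ℓ²(X)` by twisted
translations; for nondegenerate `σ` any two C⋆-algebras so generated are isomorphic, and in general
this is the universal one, since the abelian group `X` is amenable. -/
def WeylAlgebra : Type _ := weylSubalgebra σ

instance : CStarAlgebra (WeylAlgebra σ) :=
  inferInstanceAs (CStarAlgebra (weylSubalgebra σ))

instance : PartialOrder (WeylAlgebra σ) := CStarAlgebra.spectralOrder _

instance : StarOrderedRing (WeylAlgebra σ) := CStarAlgebra.spectralOrderedRing _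

/-- An operator in the generated C⋆-algebra, as an element of the Weyl algebra. -/
def WeylAlgebra.mk (x : lp (fun _ : X => ℂ) 2 →L[ℂ] lp (fun _ : X => ℂ) 2)
    (hx : x ∈ weylSubalgebra σ) : WeylAlgebra σ := ⟨x, hx⟩

/-- The generator `δ_f` of the Weyl algebra. -/
def weyl (f : X) : WeylAlgebra σ :=
  WeylAlgebra.mk σ (weylOp σ f) (StarSubalgebra.le_topologicalClosure _
    (StarAlgebra.subset_adjoin ℂ _ (Set.mem_range_self f)))

lemma weyl_mul (f g : X) : weyl σ f * weyl σ g = phase σ f g • weyl σ (f + g) :=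
  Subtype.ext (weylOp_mul σ f g)

lemma star_weyl (f : X) : star (weyl σ f) = weyl σ (-f) :=
  Subtype.ext (star_weylOp σ f)

lemma weyl_zero : weyl σ 0 = 1 := Subtype.ext (weylOp_zero σ)

lemma weyl_neg_mul (f : X) : weyl σ (-f) * weyl σ f = 1 := Subtype.ext (weylOp_neg_mul σ f)

/-- A state `ω` of the Weyl algebra is strongly regular if all the functions
`(λ₁, …, λₙ) ↦ ω(δ_{λ₁f₁} ⋯ δ_{λₙfₙ})` are smooth. -/
def IsStronglyRegular (ω : WeylAlgebra σ →ₚ[ℂ] ℂ) : Prop :=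
  ∀ (n : ℕ) (f : Fin n → X), ContDiff ℝ ((⊤ : ℕ∞) : WithTop ℕ∞) (fun l : Fin n → ℝ =>
    ω ((List.ofFn fun k => weyl σ (l k • f k)).prod))

/-- The strongly regular states (positive, normalized) of the Weyl algebra. -/
abbrev StronglyRegularState : Type _ :=
  {ω : WeylAlgebra σ →ₚ[ℂ] ℂ // ω 1 = 1 ∧ IsStronglyRegular σ ω}

end Weyl

section DirectSum

variable {ι A : Type*} [CStarAlgebra A] {E : ι → Type*} [∀ i, NormedAddCommGroup (E i)]
  [∀ i, InnerProductSpace ℂ (E i)] [∀ i, CompleteSpace (E i)]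

lemma norm_rep_apply_le {H : Type*} [NormedAddCommGroup H] [InnerProductSpace ℂ H]
    [CompleteSpace H] (π : A →⋆ₐ[ℂ] (H →L[ℂ] H)) (a : A) (x : H) : ‖π a x‖ ≤ ‖a‖ * ‖x‖ :=
  (π a).le_of_opNorm_le (NonUnitalStarAlgHom.norm_apply_le π a) x

lemma summable_directSum (π : ∀ i, A →⋆ₐ[ℂ] (E i →L[ℂ] E i)) (a : A) (ψ : lp E 2) :
    Summable (fun i => ‖π i a (ψ i)‖ ^ (2 : ENNReal).toReal) ∧
    ∑' i, ‖π i a (ψ i)‖ ^ (2 : ENNReal).toReal ≤ (‖a‖ * ‖ψ‖) ^ (2 : ENNReal).toReal := by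
  have h := (lp.hasSum_norm (p := 2) (by norm_num) ψ).mul_left (‖a‖ ^ (2 : ENNReal).toReal)
  have hle : ∀ i, ‖π i a (ψ i)‖ ^ (2 : ENNReal).toReal ≤
      ‖a‖ ^ (2 : ENNReal).toReal * ‖ψ i‖ ^ (2 : ENNReal).toReal := fun i => by
    rw [← Real.mul_rpow (norm_nonneg _) (norm_nonneg _)]
    exact Real.rpow_le_rpow (norm_nonneg _) (norm_rep_apply_le (π i) a (ψ i)) (by norm_num)
  have hs := Summable.of_nonneg_of_le (fun i => by positivity) hle h.summable
  refine ⟨hs, ?_⟩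
  rw [Real.mul_rpow (norm_nonneg _) (norm_nonneg _), ← h.tsum_eq]
  exact hs.tsum_le_tsum hle h.summable

/-- The direct sum of a family of representations, on the Hilbert space direct sum. -/
def directSumRep (π : ∀ i, A →⋆ₐ[ℂ] (E i →L[ℂ] E i)) : A →⋆ₐ[ℂ] (lp E 2 →L[ℂ] lp E 2) where
  toFun a := LinearMap.mkContinuous
    { toFun := fun ψ => ⟨fun i => π i a (ψ i), memℓp_gen (summable_directSum π a ψ).1⟩
      map_add' := fun ψ φ => by ext i; exact map_add (π i a) (ψ i) (φ i)
      map_smul' := fun c ψ => by ext i; simp }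
    ‖a‖ (fun ψ => lp.norm_le_of_tsum_le (by norm_num) (by positivity)
      (summable_directSum π a ψ).2)
  map_one' := by ext ψ i; simp
  map_mul' a b := by ext ψ i; simp
  map_zero' := by ext ψ i; simp
  map_add' a b := by ext ψ i; exact congrArg (fun T => T (ψ i)) (map_add (π i) a b)
  commutes' r := by ext ψ i; simp [Algebra.algebraMap_eq_smul_one]
  map_star' a := by
    rw [ContinuousLinearMap.star_eq_adjoint, ContinuousLinearMap.eq_adjoint_iff]
    intro ψ φ
    rw [lp.inner_eq_tsum, lp.inner_eq_tsum]
    refine tsum_congr fun i => ?_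
    change ⟪π i (star a) (ψ i), φ i⟫_ℂ = ⟪ψ i, π i a (φ i)⟫_ℂ
    rw [map_star, ContinuousLinearMap.star_eq_adjoint, ContinuousLinearMap.adjoint_inner_left]

@[simp] lemma directSumRep_apply (π : ∀ i, A →⋆ₐ[ℂ] (E i →L[ℂ] E i)) (a : A) (ψ : lp E 2)
    (i : ι) : directSumRep π a ψ i = π i a (ψ i) := rfl

end DirectSum

section Continuity

variable {X : Type*} [AddCommGroup X] [Module ℝ X] (σ : SymplecticForm X)

variable {H : Type*} [NormedAddCommGroup H] [InnerProductSpace ℂ H] [CompleteSpace H]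

lemma norm_weyl_le (f : X) : ‖weyl σ f‖ ≤ 1 :=
  ContinuousLinearMap.opNorm_le_bound _ zero_le_one fun ξ => by
    rw [one_mul]; exact (norm_weylOp_apply σ f ξ).le

/-- The vectors on which `t ↦ π(δ_{tf})` is continuous form a subspace. -/
def contVec (π : WeylAlgebra σ →⋆ₐ[ℂ] (H →L[ℂ] H)) (f : X) : Submodule ℂ H where
  carrier := {ψ | Continuous fun t : ℝ => π (weyl σ (t • f)) ψ}
  add_mem' {a b} ha hb := by
    simp only [Set.mem_ofPred_eq, map_add] at *
    exact ha.add hb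
  zero_mem' := by simpa using continuous_const
  smul_mem' c a ha := by
    simp only [Set.mem_ofPred_eq, map_smul] at *
    exact ha.const_smul c

lemma isClosed_contVec (π : WeylAlgebra σ →⋆ₐ[ℂ] (H →L[ℂ] H)) (f : X) :
    IsClosed (contVec σ π f : Set H) := by
  refine isClosed_of_closure_subset fun ψ hψ => ?_
  change Continuous fun t : ℝ => π (weyl σ (t • f)) ψ
  refine Metric.continuous_iff.mpr ?_ |> fun h => h
  intro t ε hε
  obtain ⟨φ, hφ, hd⟩ := Metric.mem_closure_iff.mp hψ (ε / 3) (by positivity)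
  have hφ' : Continuous fun t : ℝ => π (weyl σ (t • f)) φ := hφ
  obtain ⟨d, hd0, hd1⟩ := Metric.continuous_iff.mp hφ' t (ε / 3) (by positivity)
  have key : ∀ s : ℝ, dist (π (weyl σ (s • f)) ψ) (π (weyl σ (s • f)) φ) ≤ dist ψ φ := fun s => by
    rw [dist_eq_norm, dist_eq_norm, ← map_sub]
    refine (norm_rep_apply_le π _ _).trans ?_
    exact mul_le_of_le_one_left (norm_nonneg _) (norm_weyl_le σ _)
  refine ⟨d, hd0, fun s hs => ?_⟩
  have h1 := hd1 s hs
  have h2 := key s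
  have h3 := key t
  rw [dist_comm] at h3
  calc _ ≤ _ := dist_triangle4 _ (π (weyl σ (s • f)) φ) (π (weyl σ (t • f)) φ) _
    _ < ε := by linarith

/-- `contVec` is invariant under the whole Weyl algebra. -/
lemma rep_mem_contVec (π : WeylAlgebra σ →⋆ₐ[ℂ] (H →L[ℂ] H)) (f : X) (a : WeylAlgebra σ)
    (ψ : H) (hψ : ψ ∈ contVec σ π f) : π a ψ ∈ contVec σ π f := by
  have hgen : ∀ (g : X) (ψ : H), ψ ∈ contVec σ π f → π (weyl σ g) ψ ∈ contVec σ π f := by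
    intro g ψ hψ
    have hψ' : Continuous fun t : ℝ => π (weyl σ (t • f)) ψ := hψ
    change Continuous fun t : ℝ => π (weyl σ (t • f)) (π (weyl σ g) ψ)
    have : ∀ t : ℝ, π (weyl σ (t • f)) (π (weyl σ g) ψ) =
        (phase σ (t • f) g * phase σ (t • f) g) • π (weyl σ g) (π (weyl σ (t • f)) ψ) := by
      intro t
      have h1 : weyl σ (t • f) * weyl σ g =
          (phase σ (t • f) g * phase σ (t • f) g) • (weyl σ g * weyl σ (t • f)) := by
        rw [weyl_mul, weyl_mul, smul_smul, add_comm g]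
        congr 1
        simp only [phase, ← Complex.exp_add, form_swap σ (t • f) g]
        congr 1
        push_cast
        ring
      rw [← mul_apply_eq_comp, ← map_mul, h1, map_smul, map_mul]
      rfl
    simp only [this]
    refine Continuous.smul ?_ ((π (weyl σ g)).continuous.comp hψ')
    have : Continuous fun t : ℝ => phase σ (t • f) g := by
      simp only [phase, map_smul, LinearMap.smul_apply, smul_eq_mul]
      fun_prop
    exact this.mul this
  have hadj : ∀ x ∈ Algebra.adjoin ℂ (Set.range (weylOp σ) ∪ star (Set.range (weylOp σ))),
      ∀ (hx : x ∈ weylSubalgebra σ), ∀ ψ ∈ contVec σ π f,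
        π (WeylAlgebra.mk σ x hx) ψ ∈ contVec σ π f := by
    have hsub : ∀ x ∈ Algebra.adjoin ℂ (Set.range (weylOp σ) ∪ star (Set.range (weylOp σ))),
        x ∈ weylSubalgebra σ := fun x hx => StarSubalgebra.le_topologicalClosure
          (StarAlgebra.adjoin ℂ (Set.range (weylOp σ))) hx
    intro x hx
    induction hx using Algebra.adjoin_induction with
    | mem x hx =>
      intro hx' ψ hψ
      obtain ⟨g, rfl⟩ | ⟨g, hg⟩ := hx
      · exact hgen g ψ hψ
      · have : x = weylOp σ (-g) := by rw [← star_weylOp, hg, star_star]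
        subst this
        exact hgen (-g) ψ hψ
    | algebraMap r =>
      intro hx' ψ hψ
      have : WeylAlgebra.mk σ (algebraMap ℂ _ r) (hx') = r • (1 : WeylAlgebra σ) :=
        Subtype.ext (Algebra.algebraMap_eq_smul_one r)
      rw [this, map_smul, map_one]
      exact (contVec σ π f).smul_mem r hψ
    | add x y hx hy h1 h2 =>
      intro hx' ψ hψ
      have : WeylAlgebra.mk σ (x + y) (hx') = WeylAlgebra.mk σ (x) (hsub x hx) +
        WeylAlgebra.mk σ (y) (hsub y hy) := rfl
      rw [this, map_add]
      exact (contVec σ π f).add_mem (h1 _ ψ hψ) (h2 _ ψ hψ)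
    | mul x y hx hy h1 h2 =>
      intro hx' ψ hψ
      have : WeylAlgebra.mk σ (x * y) (hx') = WeylAlgebra.mk σ (x) (hsub x hx) *
        WeylAlgebra.mk σ (y) (hsub y hy) := rfl
      rw [this, map_mul]
      exact h1 _ _ (h2 _ ψ hψ)
  rw [← SetLike.mem_coe, ← (isClosed_contVec σ π f).closure_eq, Metric.mem_closure_iff]
  intro ε hε
  have hpos : 0 < ‖ψ‖ + 1 := by positivity
  obtain ⟨b, hb, hd⟩ := Metric.mem_closure_iff.mp
    (show a.1 ∈ closure (StarAlgebra.adjoin ℂ (Set.range (weylOp σ)) : Set _) from a.2)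
    (ε / (‖ψ‖ + 1)) (by positivity)
  have hb' : b ∈ weylSubalgebra σ := StarSubalgebra.le_topologicalClosure _ hb
  refine ⟨π (WeylAlgebra.mk σ b hb') ψ, hadj b hb hb' ψ hψ, ?_⟩
  rw [dist_eq_norm] at hd ⊢
  have h1 : π a ψ - π (WeylAlgebra.mk σ b hb') ψ = π (a - WeylAlgebra.mk σ b hb') ψ := by
    rw [map_sub]; rfl
  rw [h1]
  have h2 : ‖a - WeylAlgebra.mk σ b hb'‖ < ε / (‖ψ‖ + 1) := hd
  calc _ ≤ ‖a - WeylAlgebra.mk σ b hb'‖ * ‖ψ‖ := norm_rep_apply_le π _ ψ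
    _ ≤ ‖a - WeylAlgebra.mk σ b hb'‖ * (‖ψ‖ + 1) := by gcongr; linarith
    _ < ε := by rwa [lt_div_iff₀ hpos] at h2

/-- In the GNS representation of a strongly regular state, `t ↦ π(δ_{tf})` is strongly
continuous. -/
lemma gns_contVec (s : StronglyRegularState σ) (f : X) (x : s.1.GNS) :
    x ∈ contVec σ s.1.gnsStarAlgHom f := by
  have hΩ : ((s.1.toPreGNS 1 : s.1.PreGNS) : s.1.GNS) ∈ contVec σ s.1.gnsStarAlgHom f := by
    have hcont : Continuous fun l : Fin 2 → ℝ => s.1 (weyl σ (l 0 • f) * weyl σ (l 1 • f)) := by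
      have := (s.2.2 2 (fun _ => f)).continuous
      simpa [List.ofFn_succ] using this
    have hu : ∀ t : ℝ, s.1.gnsStarAlgHom (weyl σ (t • f)) ((s.1.toPreGNS 1 : s.1.PreGNS) : s.1.GNS)
        = ((s.1.toPreGNS (weyl σ (t • f)) : s.1.PreGNS) : s.1.GNS) := by
      intro t
      simp
    change Continuous fun t : ℝ => s.1.gnsStarAlgHom (weyl σ (t • f))
      ((s.1.toPreGNS 1 : s.1.PreGNS) : s.1.GNS)
    simp only [hu]
    refine (UniformSpace.Completion.continuous_coe _).comp ?_
    have hn : ∀ t r : ℝ, ‖s.1.toPreGNS (weyl σ (t • f)) - s.1.toPreGNS (weyl σ (r • f))‖ =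
        √(2 - (s.1 (weyl σ ((-t) • f) * weyl σ (r • f))).re
          - (s.1 (weyl σ ((-r) • f) * weyl σ (t • f))).re) := by
      intro t r
      rw [← map_sub, PositiveLinearMap.preGNS_norm_def, PositiveLinearMap.ofPreGNS_toPreGNS]
      congr 1
      rw [star_sub, star_weyl, star_weyl, sub_mul, mul_sub, mul_sub, weyl_neg_mul, weyl_neg_mul]
      simp only [map_sub, s.2.1, neg_smul, Complex.sub_re, Complex.one_re]
      ring
    rw [continuous_iff_continuousAt]
    intro r
    rw [ContinuousAt, tendsto_iff_norm_sub_tendsto_zero]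
    simp only [hn]
    have hc : ∀ u v : ℝ → ℝ, Continuous u → Continuous v →
        Continuous fun t => (s.1 (weyl σ (u t • f) * weyl σ (v t • f))).re := by
      intro u v hu hv
      have := Complex.continuous_re.comp (hcont.comp
        (show Continuous fun t => (![u t, v t] : Fin 2 → ℝ) by fun_prop))
      simpa [Function.comp_def] using this
    have hall : Continuous fun t : ℝ => √(2 - (s.1 (weyl σ ((-t) • f) * weyl σ (r • f))).re
          - (s.1 (weyl σ ((-r) • f) * weyl σ (t • f))).re) :=
      ((continuous_const.sub (hc _ _ continuous_neg continuous_const)).sub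
        (hc _ _ continuous_const continuous_id)).sqrt
    have h0 := hall.tendsto r
    have hz : 2 - (s.1 (weyl σ ((-r) • f) * weyl σ (r • f))).re
          - (s.1 (weyl σ ((-r) • f) * weyl σ (r • f))).re = 0 := by
      rw [neg_smul, weyl_neg_mul, s.2.1]
      norm_num
    rwa [hz, Real.sqrt_zero] at h0
  have hcoe : ∀ a : s.1.PreGNS, (a : s.1.GNS) ∈ contVec σ s.1.gnsStarAlgHom f := by
    intro a
    have := rep_mem_contVec σ s.1.gnsStarAlgHom f (s.1.ofPreGNS a) _ hΩ
    simpa using this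
  induction x using UniformSpace.Completion.induction_on with
  | hp => exact isClosed_contVec σ s.1.gnsStarAlgHom f
  | ih a => exact hcoe a

end Continuity

section Resolvent

variable {X : Type*} [AddCommGroup X] [Module ℝ X] (σ : SymplecticForm X)

/-- The Hilbert space direct sum of the GNS spaces of all strongly regular states. -/
def RegularSpace : Type _ := lp (fun s : StronglyRegularState σ => s.1.GNS) 2

instance : NormedAddCommGroup (RegularSpace σ) :=
  inferInstanceAs (NormedAddCommGroup (lp (fun s : StronglyRegularState σ => s.1.GNS) 2))

instance : InnerProductSpace ℂ (RegularSpace σ) :=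
  inferInstanceAs (InnerProductSpace ℂ (lp (fun s : StronglyRegularState σ => s.1.GNS) 2))

instance : CompleteSpace (RegularSpace σ) :=
  inferInstanceAs (CompleteSpace (lp (fun s : StronglyRegularState σ => s.1.GNS) 2))

/-- The inclusion of the GNS space of one strongly regular state as a direct summand. -/
def RegularSpace.incl [DecidableEq (StronglyRegularState σ)] (s : StronglyRegularState σ)
    (x : s.1.GNS) : RegularSpace σ :=
  (lp.single 2 s x : lp (fun s : StronglyRegularState σ => s.1.GNS) 2)

/-- `π_S`, the direct sum of the GNS representations of all strongly regular states. -/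
def regularRep : WeylAlgebra σ →⋆ₐ[ℂ] (RegularSpace σ →L[ℂ] RegularSpace σ) :=
  directSumRep fun s : StronglyRegularState σ => s.1.gnsStarAlgHom

lemma regularRep_incl [DecidableEq (StronglyRegularState σ)] (a : WeylAlgebra σ)
    (s : StronglyRegularState σ) (x : s.1.GNS) :
    regularRep σ a (RegularSpace.incl σ s x) = RegularSpace.incl σ s (s.1.gnsStarAlgHom a x) := by
  change directSumRep (fun s : StronglyRegularState σ => s.1.gnsStarAlgHom) a (lp.single 2 s x) =
    lp.single 2 s (s.1.gnsStarAlgHom a x)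
  ext r
  rw [directSumRep_apply]
  by_cases h : r = s
  · subst h
    rw [lp.single_apply_self, lp.single_apply_self]
  · rw [lp.single_apply_ne _ _ _ h, lp.single_apply_ne _ _ _ h, map_zero]

lemma continuous_regularRep (f : X) (ψ : RegularSpace σ) :
    Continuous fun t : ℝ => regularRep σ (weyl σ (t • f)) ψ := by
  classical
  change ψ ∈ contVec σ (regularRep σ) f
  have hsingle : ∀ (s : StronglyRegularState σ) (x : s.1.GNS),
      RegularSpace.incl σ s x ∈ contVec σ (regularRep σ) f := by
    intro s x
    change Continuous fun t : ℝ => regularRep σ (weyl σ (t • f)) (RegularSpace.incl σ s x)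
    simp only [regularRep_incl]
    exact (lp.isometry_single s).continuous.comp (gns_contVec σ s f x)
  have hsum : HasSum (fun s : StronglyRegularState σ =>
      RegularSpace.incl σ s ((show lp (fun s : StronglyRegularState σ => s.1.GNS) 2 from ψ) s)) ψ :=
    lp.hasSum_single (by norm_num) (show lp (fun s : StronglyRegularState σ => s.1.GNS) 2 from ψ)
  exact (isClosed_contVec σ (regularRep σ) f).mem_of_tendsto hsum
    (Filter.Eventually.of_forall fun F => (contVec σ (regularRep σ) f).sum_mem
      fun s _ => hsingle s _)

lemma norm_laplace_integrand_le (l : ℝ) (f : X) (ψ : RegularSpace σ) (t : ℝ) :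
    ‖(Real.exp (-(l * t)) : ℂ) • regularRep σ (weyl σ ((-t) • f)) ψ‖ ≤ Real.exp (-l * t) * ‖ψ‖ := by
  rw [norm_smul, Complex.norm_real, Real.norm_of_nonneg (Real.exp_pos _).le, neg_mul]
  refine mul_le_mul_of_nonneg_left ?_ (Real.exp_pos _).le
  exact (norm_rep_apply_le _ _ _).trans (mul_le_of_le_one_left (norm_nonneg _) (norm_weyl_le σ _))

lemma integrableOn_laplace {l : ℝ} (hl : 0 < l) (f : X) (ψ : RegularSpace σ) :
    MeasureTheory.IntegrableOn
      (fun t : ℝ => (Real.exp (-(l * t)) : ℂ) • regularRep σ (weyl σ ((-t) • f)) ψ) (Set.Ioi 0) := by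
  have hc : Continuous fun t : ℝ => (Real.exp (-(l * t)) : ℂ) • regularRep σ (weyl σ ((-t) • f)) ψ :=
    (by fun_prop : Continuous fun t : ℝ => (Real.exp (-(l * t)) : ℂ)).smul
      ((continuous_regularRep σ f ψ).comp continuous_neg)
  exact MeasureTheory.Integrable.mono' ((exp_neg_integrableOn_Ioi 0 hl).mul_const ‖ψ‖)
    hc.aestronglyMeasurable.restrict
    (Filter.Eventually.of_forall (norm_laplace_integrand_le σ l f ψ))

/-- The Laplace transform `-i ∫₀^∞ exp(-λt) π_S(δ_{-tf}) dt`, `λ > 0`, as a strong integral. -/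
def laplaceOp (l : ℝ) (hl : 0 < l) (f : X) : RegularSpace σ →L[ℂ] RegularSpace σ :=
  LinearMap.mkContinuous
    { toFun := fun ψ => -Complex.I •
        ∫ t in Set.Ioi (0 : ℝ), (Real.exp (-(l * t)) : ℂ) • regularRep σ (weyl σ ((-t) • f)) ψ
      map_add' := fun ψ φ => by
        rw [← smul_add, ← MeasureTheory.integral_add (integrableOn_laplace σ hl f ψ)
          (integrableOn_laplace σ hl f φ)]
        refine congrArg _ (MeasureTheory.setIntegral_congr_fun measurableSet_Ioi fun t _ => ?_)
        rw [map_add, smul_add]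
      map_smul' := fun c ψ => by
        rw [RingHom.id_apply, smul_comm c]
        refine congrArg (fun v => -Complex.I • v) ?_
        refine Eq.trans ?_ (MeasureTheory.integral_smul c _)
        refine MeasureTheory.setIntegral_congr_fun measurableSet_Ioi fun t _ => ?_
        rw [map_smul, smul_comm c] }
    l⁻¹ (fun ψ => by
      change ‖-Complex.I • ∫ t in Set.Ioi (0 : ℝ),
        (Real.exp (-(l * t)) : ℂ) • regularRep σ (weyl σ ((-t) • f)) ψ‖ ≤ _
      rw [norm_smul, norm_neg, Complex.norm_I, one_mul]
      refine (MeasureTheory.norm_integral_le_of_norm_le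
        ((exp_neg_integrableOn_Ioi 0 hl).mul_const ‖ψ‖)
        (Filter.Eventually.of_forall (norm_laplace_integrand_le σ l f ψ))).trans ?_
      rw [MeasureTheory.integral_mul_const]
      have : ∫ t in Set.Ioi (0 : ℝ), Real.exp (-l * t) = l⁻¹ := by
        simpa [hl.ne', neg_div, div_neg] using integral_exp_mul_Ioi (neg_lt_zero.mpr hl) 0
      rw [this])

open Classical in
/-- `π_S(R(λ,f))` for `λ ≠ 0`: the Laplace transform for `λ > 0`, and `R(λ,f) = R(-λ,f)⋆` for
`λ < 0` (junk value `0` at `λ = 0`). -/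
def resolventOp (l : ℝ) (f : X) : RegularSpace σ →L[ℂ] RegularSpace σ :=
  if h : 0 < l then laplaceOp σ l h f
  else if h : 0 < -l then star (laplaceOp σ (-l) h f) else 0

/-- The C⋆-algebra of operators generated by `1` and the `π_S(R(λ,f))`, `λ ≠ 0`, `f ≠ 0`. -/
def resolventSubalgebra : StarSubalgebra ℂ (RegularSpace σ →L[ℂ] RegularSpace σ) :=
  (StarAlgebra.adjoin ℂ
    {T | ∃ (l : ℝ) (f : X), l ≠ 0 ∧ f ≠ 0 ∧ T = resolventOp σ l f}).topologicalClosure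

instance : IsClosed (resolventSubalgebra σ : Set (RegularSpace σ →L[ℂ] RegularSpace σ)) :=
  StarSubalgebra.isClosed_topologicalClosure _

end Resolvent

end

end ResolventAlgebra

open ResolventAlgebra

noncomputable section

/-- The resolvent algebra `R(X, σ)`: the C⋆-algebra generated by the resolvents in the direct sum
of the GNS representations of all strongly regular states of the Weyl algebra. -/
abbrev ResolventAlg {X : Type*} [AddCommGroup X] [Module ℝ X] (σ : SymplecticForm X) : Type _ :=
  resolventSubalgebra σ

namespace ResolventAlgebra

variable {X : Type*} [AddCommGroup X] [Module ℝ X] (σ : SymplecticForm X)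

open Classical in
/-- The generator `R(λ,f)`, `λ ≠ 0`, `f ≠ 0`, of the resolvent algebra (junk value `0` for `λ = 0`
or `f = 0`, where `R(λ,f)` is not defined). -/
def R (l : ℝ) (f : X) : ResolventAlg σ :=
  if h : l ≠ 0 ∧ f ≠ 0 then
    ⟨resolventOp σ l f, StarSubalgebra.le_topologicalClosure _
      (StarAlgebra.subset_adjoin ℂ _ ⟨l, f, h.1, h.2, rfl⟩)⟩
  else 0

/-- The `n`-th term `(μ - z)ⁿ iⁿ R(μ,f)ⁿ⁺¹` of the von Neumann series of `R(z,f)` at `μ`. -/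
def neumannTerm (μ : ℝ) (z : ℂ) (f : X) (n : ℕ) : ResolventAlg σ :=
  (((μ : ℂ) - z) ^ n * Complex.I ^ n) • R σ μ f ^ (n + 1)

/-- `R(z,f)` for complex `z` with `Re z ≠ 0`, by the von Neumann series, which converges at any
real centre `μ` with `|z - μ| < |μ|`; the centre used here is `μ = |z|² / Re z`. -/
def complexR (z : ℂ) (f : X) : ResolventAlg σ :=
  ∑' n, neumannTerm σ (‖z‖ ^ 2 / z.re) z f n

variable {σ}
variable {H : Type*} [NormedAddCommGroup H] [InnerProductSpace ℂ H] [CompleteSpace H]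

open Classical in
/-- The field operator `j_π(f) = i - π(R(1,f))⁻¹` with domain `Ran π(R(1,f))`, for `f ≠ 0` such
that `π(R(1,f))` is injective; and `j_π(0) = 0`. -/
def field (π : ResolventAlg σ →⋆ₙₐ[ℂ] (H →L[ℂ] H)) (f : X) : H →ₗ.[ℂ] H :=
  if f = 0 then 0
  else (Complex.I • LinearMap.id : H →ₗ[ℂ] H).toPMap ⊤ -
    ((π (R σ 1 f) : H →ₗ[ℂ] H).toPMap ⊤).inverse

/-- The space `D = π(R(1,f) R(1,h)) H`. -/
def jointDomain (π : ResolventAlg σ →⋆ₙₐ[ℂ] (H →L[ℂ] H)) (f h : X) : Submodule ℂ H :=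
  LinearMap.range (π (R σ 1 f * R σ 1 h) : H →ₗ[ℂ] H)

/-- `U` is the unitary group `t ↦ exp(itA)` generated by the operator `A`: a strongly continuous
one-parameter group of unitaries such that `d/dt U(t)ψ = iAψ` at `t = 0`, where `Dom A` is exactly
the set of vectors `ψ` at which this derivative exists. -/
structure IsUnitaryGroupOf (A : H →ₗ.[ℂ] H) (U : ℝ → H →L[ℂ] H) : Prop where
  mem_unitary : ∀ t, U t ∈ unitary (H →L[ℂ] H)
  map_add : ∀ s t, U (s + t) = U s * U t
  continuous : ∀ ψ, Continuous fun t => U t ψ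
  generator : ∀ ψ φ, (ψ, φ) ∈ A.graph ↔ HasDerivAt (fun t => U t ψ) (Complex.I • φ) 0

open Classical in
/-- `exp(iA)` for a selfadjoint operator `A`: the value at `t = 1` of the unitary group `exp(itA)`
(junk value `0` if there is no such group). -/
def expI (A : H →ₗ.[ℂ] H) : H →L[ℂ] H :=
  if h : ∃ U, IsUnitaryGroupOf A U then h.choose 1 else 0

end ResolventAlgebra

end

/-! In the defining representation `π_S` each group `t ↦ π_S(δ_{tf})` is strongly continuous, with
generator φ(f), and R(λ,f) acts there as `(iλ - φ(f))⁻¹`. The Weyl relations say that δ_{sf} shifts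
φ(g) by sσ(f,g). Differentiating at s = 0 gives [φ(f), R(λ,g)] = iσ(f,g)R(λ,g)². The phase in
δ_{t(lf+h)} is quadratic in t, so φ(lf+h) = lφ(f) + φ(h) on common vectors.

An abstract π need not see δ_f or φ(f), so each fact is rewritten as an equation between bounded
elements: the resolvent identity `R_sub`, the scaling `R_smul`, the commutator `R_commutator` and
the sum `R_sum`. These are equations in the C⋆-algebra and survive any π. Where π(R(1,f)) is
injective, the operators π(R(λ,f)) are the resolvents of `field π f` (`isResolventFamily_field`).
Selfadjointness, the limits and the products then use only the adjoint, norm and resolvent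
identities; the commutation relations, the linearity, the dense domain and the core follow by
applying the bounded equations to suitable vectors.

The unitary groups come from Stone's theorem, proved by Yosida approximation. A Gronwall argument
(`IsUnitaryGroup.intertwine`) integrates the commutator to W(f)R = RW(f) - σ(f,h)RW(f)R, where R =
π(R(λ,h)). This one relation gives the action on resolvents, the invariance of the joint domain and
the shift of `field π h` by W(f). Uniqueness of unitary groups turns the shift into the Weyl
relation. -/

noncomputable section

namespace ResolventAlgebra

open MeasureTheory Filter Topology

/-! ### Unitary groups and their generators -/

section UnitaryGroups

set_option linter.unusedSectionVars false

variable {H : Type*} [NormedAddCommGroup H] [InnerProductSpace ℂ H] [CompleteSpace H]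

/-- A strongly continuous one-parameter group of unitaries. -/
structure IsUnitaryGroup (U : ℝ → H →L[ℂ] H) : Prop where
  mem_unitary : ∀ t, U t ∈ unitary (H →L[ℂ] H)
  map_add : ∀ s t, U (s + t) = U s * U t
  continuous : ∀ ψ, Continuous fun t => U t ψ

/-- `(ψ, φ)` lies in the graph of the infinitesimal generator of `U`. -/
def HasGen (U : ℝ → H →L[ℂ] H) (ψ φ : H) : Prop :=
  HasDerivAt (fun t => U t ψ) (Complex.I • φ) 0

variable {U V : ℝ → H →L[ℂ] H}

lemma IsUnitaryGroupOf.isUnitaryGroup {A : H →ₗ.[ℂ] H} (h : IsUnitaryGroupOf A U) :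
    IsUnitaryGroup U := ⟨h.1, h.2, h.3⟩

namespace IsUnitaryGroup

lemma map_zero (hU : IsUnitaryGroup U) : U 0 = 1 := by
  have h := hU.map_add 0 0
  rw [add_zero] at h
  have h1 := (Unitary.mem_iff.mp (hU.mem_unitary 0)).1
  calc U 0 = (star (U 0) * U 0) * U 0 := by rw [h1, one_mul]
    _ = star (U 0) * U 0 := by rw [mul_assoc, ← h]
    _ = 1 := h1

lemma map_zero_apply (hU : IsUnitaryGroup U) (ψ : H) : U 0 ψ = ψ := by
  rw [hU.map_zero, one_apply_eq_self]

lemma map_add_apply (hU : IsUnitaryGroup U) (s t : ℝ) (ψ : H) : U (s + t) ψ = U s (U t ψ) := by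
  rw [hU.map_add, mul_apply_eq_comp]

lemma comm_apply (hU : IsUnitaryGroup U) (s t : ℝ) (ψ : H) : U s (U t ψ) = U t (U s ψ) := by
  rw [← hU.map_add_apply, ← hU.map_add_apply, add_comm]

lemma inner_map (hU : IsUnitaryGroup U) (t : ℝ) (ψ φ : H) : ⟪U t ψ, U t φ⟫_ℂ = ⟪ψ, φ⟫_ℂ := by
  have h1 := (Unitary.mem_iff.mp (hU.mem_unitary t)).1
  rw [← ContinuousLinearMap.adjoint_inner_right, ← ContinuousLinearMap.star_eq_adjoint,
    ← mul_apply_eq_comp, h1, one_apply_eq_self]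

lemma norm_map (hU : IsUnitaryGroup U) (t : ℝ) (ψ : H) : ‖U t ψ‖ = ‖ψ‖ := by
  have h := hU.inner_map t ψ ψ
  rw [inner_self_eq_norm_sq_to_K, inner_self_eq_norm_sq_to_K] at h
  have h2 : ‖U t ψ‖ ^ 2 = ‖ψ‖ ^ 2 := by exact_mod_cast h
  exact (pow_left_inj₀ (norm_nonneg _) (norm_nonneg _) two_ne_zero).mp h2

end IsUnitaryGroup

lemma hasDerivAt_clm_apply (S : H →L[ℂ] H) {g : ℝ → H} {g' : H} {s : ℝ} (h : HasDerivAt g g' s) :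
    HasDerivAt (fun t => S (g t)) (S g') s :=
  (S.hasFDerivAt.restrictScalars ℝ).comp_hasDerivAt s h

namespace HasGen

lemma add {ψ φ ψ' φ' : H} (h : HasGen U ψ φ) (h' : HasGen U ψ' φ') :
    HasGen U (ψ + ψ') (φ + φ') := by
  have := HasDerivAt.add h h'
  rw [← smul_add] at this
  refine this.congr_of_eventuallyEq (Eventually.of_forall fun t => ?_)
  simp

lemma smul {ψ φ : H} (h : HasGen U ψ φ) (c : ℂ) : HasGen U (c • ψ) (c • φ) := by
  have := HasDerivAt.const_smul c h
  rw [smul_comm] at this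
  refine this.congr_of_eventuallyEq (Eventually.of_forall fun t => ?_)
  simp

lemma sub {ψ φ ψ' φ' : H} (h : HasGen U ψ φ) (h' : HasGen U ψ' φ') :
    HasGen U (ψ - ψ') (φ - φ') := by
  have := h.add (h'.smul (-1))
  simpa [sub_eq_add_neg] using this

lemma map (hU : IsUnitaryGroup U) {ψ φ : H} (h : HasGen U ψ φ) (s : ℝ) :
    HasGen U (U s ψ) (U s φ) := by
  have h2 := hasDerivAt_clm_apply (U s) h
  rw [map_smul] at h2
  exact h2.congr_of_eventuallyEq (Eventually.of_forall fun t => hU.comm_apply t s ψ)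

lemma hasDerivAt (hU : IsUnitaryGroup U) {ψ φ : H} (h : HasGen U ψ φ) (s : ℝ) :
    HasDerivAt (fun t => U t ψ) (Complex.I • U s φ) s := by
  have h1 : HasDerivAt (fun t => U t (U s ψ)) (Complex.I • U s φ) (s - s) := by
    rw [sub_self]; exact h.map hU s
  have h2 := HasDerivAt.scomp (h := fun t : ℝ => t - s) s h1 ((hasDerivAt_id s).sub_const s)
  rw [one_smul] at h2
  refine h2.congr_of_eventuallyEq (Eventually.of_forall fun t => ?_)
  simp only [Function.comp_apply]
  rw [← hU.map_add_apply, sub_add_cancel]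

lemma symm (hU : IsUnitaryGroup U) {ψ φ ψ' φ' : H} (h : HasGen U ψ φ) (h' : HasGen U ψ' φ') :
    ⟪φ, ψ'⟫_ℂ = ⟪ψ, φ'⟫_ℂ := by
  have h1 := HasDerivAt.inner ℂ h h'
  simp only [hU.inner_map, hU.map_zero_apply] at h1
  have h2 := h1.unique (hasDerivAt_const (0 : ℝ) ⟪ψ, ψ'⟫_ℂ)
  rw [inner_smul_left, inner_smul_right, Complex.conj_I] at h2
  have h3 : Complex.I * (⟪ψ, φ'⟫_ℂ - ⟪φ, ψ'⟫_ℂ) = 0 := by linear_combination h2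
  rcases mul_eq_zero.mp h3 with h4 | h4
  · exact absurd h4 Complex.I_ne_zero
  · exact (sub_eq_zero.mp h4).symm

/-- A symmetric operator has no nonreal eigenvalue. This is what prevents the generator of the group
built from `A` from being larger than `A`. -/
lemma eq_zero (hU : IsUnitaryGroup U) {l : ℝ} (hl : l ≠ 0) {ψ : H}
    (h : HasGen U ψ ((Complex.I * (l : ℂ)) • ψ)) : ψ = 0 := by
  have h1 := h.symm hU h
  rw [inner_smul_left, inner_smul_right] at h1
  simp only [map_mul, Complex.conj_I, Complex.conj_ofReal] at h1
  have h3 : (2 * Complex.I * l) * ⟪ψ, ψ⟫_ℂ = 0 := by linear_combination -h1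
  simpa [hl] using h3

/-- The real part of `⟪ψ, iφ⟫` vanishes on the graph of the generator. -/
lemma re_inner (hU : IsUnitaryGroup U) {ψ φ : H} (h : HasGen U ψ φ) :
    (⟪ψ, Complex.I • φ⟫_ℂ).re = 0 := by
  have h1 := h.symm hU h
  have h2 : (⟪ψ, φ⟫_ℂ).im = 0 := by
    rw [← inner_conj_symm φ ψ] at h1
    exact Complex.conj_eq_iff_im.mp h1
  rw [inner_smul_right]
  simp [h2]

lemma neg_iff {ψ φ : H} : HasGen (fun t => U (-t)) ψ φ ↔ HasGen U ψ (-φ) := by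
  have key : ∀ (W : ℝ → H →L[ℂ] H) (φ : H), HasGen W ψ (-φ) → HasGen (fun t => W (-t)) ψ φ := by
    intro W φ h
    have h1 : HasDerivAt (fun t => W t ψ) (Complex.I • -φ) (-0) := by rw [neg_zero]; exact h
    have h2 := HasDerivAt.scomp (h := fun t : ℝ => -t) 0 h1 (hasDerivAt_neg 0)
    simpa [Function.comp_def, HasGen] using h2
  refine ⟨fun h => ?_, key U φ⟩
  have := key (fun t => U (-t)) (-φ) (by rwa [neg_neg])
  simpa using this

end HasGen

lemma hasDerivAt_norm_sq {g : ℝ → H} {g' : H} {s : ℝ} (h : HasDerivAt g g' s) :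
    HasDerivAt (fun t => ‖g t‖ ^ 2) (2 * (⟪g s, g'⟫_ℂ).re) s := by
  have h1 := HasDerivAt.inner ℂ h h
  have h2 := (Complex.reCLM.hasFDerivAt).comp_hasDerivAt s h1
  have h3 : (⟪g', g s⟫_ℂ).re = (⟪g s, g'⟫_ℂ).re := by
    rw [← inner_conj_symm, Complex.conj_re]
  have h4 : Complex.reCLM (⟪g s, g'⟫_ℂ + ⟪g', g s⟫_ℂ) = 2 * (⟪g s, g'⟫_ℂ).re := by
    rw [Complex.reCLM_apply, Complex.add_re, h3]; ring
  rw [h4] at h2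
  refine h2.congr_of_eventuallyEq (Eventually.of_forall fun t => ?_)
  simp only [Function.comp_apply, inner_self_eq_norm_sq_to_K, Complex.reCLM_apply]
  norm_cast

/-- A unitary group is determined by its generator on a dense set. -/
lemma IsUnitaryGroup.ext_of_hasGen (hU : IsUnitaryGroup U) (hV : IsUnitaryGroup V)
    (hd : Dense {ψ | ∃ φ, HasGen U ψ φ}) (h : ∀ ψ φ, HasGen U ψ φ → HasGen V ψ φ) : U = V := by
  funext t
  refine ContinuousLinearMap.ext fun ψ => ?_
  refine congrFun (Continuous.ext_on hd (U t).continuous (V t).continuous ?_) ψ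
  rintro ψ ⟨φ, hψ⟩
  -- The difference stays in the domain of the generator of `V` and evolves by it; symmetry of that
  -- generator keeps the norm constant.
  have hder : ∀ s, HasDerivAt (fun r => ‖U r ψ - V r ψ‖ ^ 2) 0 s := by
    intro s
    have h1 := (hψ.hasDerivAt hU s).sub ((h _ _ hψ).hasDerivAt hV s)
    have h2 := hasDerivAt_norm_sq h1
    have h3 := (h _ _ (hψ.map hU s)).sub ((h _ _ hψ).map hV s)
    have h4 := h3.re_inner hV
    rw [smul_sub] at h4
    have h5 : 2 * (⟪U s ψ - V s ψ, Complex.I • U s φ - Complex.I • V s φ⟫_ℂ).re = 0 := by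
      rw [h4, mul_zero]
    rw [← h5]
    exact h2
  have h1 := is_const_of_deriv_eq_zero (fun s => (hder s).differentiableAt)
    (fun s => (hder s).deriv) t 0
  simp only [hU.map_zero_apply, hV.map_zero_apply, sub_self, norm_zero] at h1
  have h2 : ‖U t ψ - V t ψ‖ = 0 := by simpa using h1
  exact sub_eq_zero.mp (norm_eq_zero.mp h2)

lemma IsUnitaryGroup.neg (hU : IsUnitaryGroup U) : IsUnitaryGroup fun t => U (-t) where
  mem_unitary t := hU.mem_unitary _
  map_add s t := by rw [neg_add, hU.map_add]
  continuous ψ := (hU.continuous ψ).comp continuous_neg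

/-! ### The Laplace transform as resolvent of the generator -/

/-- The Laplace transform of a unitary group, applied to a vector. -/
def laplaceVec (U : ℝ → H →L[ℂ] H) (m : ℝ) (χ : H) : H :=
  -Complex.I • ∫ t in Set.Ioi (0 : ℝ), (Real.exp (-(m * t)) : ℂ) • U (-t) χ

lemma hasDerivAt_const_mul_neg (m t : ℝ) : HasDerivAt (fun t : ℝ => -(m * t)) (-m) t := by
  have := ((hasDerivAt_id' t).const_mul m).fun_neg
  rwa [mul_one] at this

section Laplace

variable (hU : IsUnitaryGroup U) {m : ℝ} (hm : 0 < m)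
include hU hm

lemma integrableOn_laplaceVec (χ : H) (a : ℝ) :
    IntegrableOn (fun t : ℝ => (Real.exp (-(m * t)) : ℂ) • U (-t) χ) (Set.Ioi a) := by
  have hc : Continuous fun t : ℝ => (Real.exp (-(m * t)) : ℂ) • U (-t) χ :=
    (by fun_prop : Continuous fun t : ℝ => (Real.exp (-(m * t)) : ℂ)).smul
      ((hU.continuous χ).comp continuous_neg)
  refine Integrable.mono' ((exp_neg_integrableOn_Ioi a hm).mul_const ‖χ‖)
    hc.aestronglyMeasurable.restrict (Eventually.of_forall fun t => ?_)
  rw [norm_smul, Complex.norm_real, Real.norm_of_nonneg (Real.exp_pos _).le, neg_mul, hU.norm_map]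

/-- Left inverse of `im - A`, `A` the generator: up to the factor `i` the integrand is the
derivative of `e^{-mt} U(-t)ψ`, which vanishes at infinity. -/
lemma laplaceVec_of_hasGen {ψ φ : H} (h : HasGen U ψ φ) :
    laplaceVec U m ((Complex.I * (m : ℂ)) • ψ - φ) = ψ := by
  set F : ℝ → H := fun t => (Real.exp (-(m * t)) : ℂ) • U (-t) ψ
  have hd : ∀ t, HasDerivAt F (Complex.I •
      ((Real.exp (-(m * t)) : ℂ) • U (-t) ((Complex.I * (m : ℂ)) • ψ - φ))) t := by
    intro t
    have h1 : HasDerivAt (fun t => U (-t) ψ) (-(Complex.I • U (-t) φ)) t := by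
      have := HasDerivAt.scomp (h := fun t : ℝ => -t) t (h.hasDerivAt hU (-t)) (hasDerivAt_neg t)
      simpa [Function.comp_def] using this
    have h2 : HasDerivAt (fun t : ℝ => (Real.exp (-(m * t)) : ℂ))
        ((Real.exp (-(m * t)) * (-m) : ℝ) : ℂ) t := by
      exact (hasDerivAt_const_mul_neg m t).exp.ofReal_comp
    have h3 := h2.smul h1
    refine h3.congr_deriv ?_
    rw [map_sub, map_smul, smul_sub, smul_sub, smul_smul, smul_smul, smul_neg, smul_smul,
      smul_smul, add_comm, sub_eq_add_neg, mul_comm Complex.I]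
    congr 2
    push_cast
    linear_combination (-(Complex.exp (-(m * t)) * m)) * Complex.I_sq
  have hlim : Tendsto F atTop (𝓝 0) := by
    rw [tendsto_zero_iff_norm_tendsto_zero]
    have : ∀ t, ‖F t‖ = Real.exp (-(m * t)) * ‖ψ‖ := fun t => by
      rw [norm_smul, Complex.norm_real, Real.norm_of_nonneg (Real.exp_pos _).le, hU.norm_map]
    simp only [this]
    have h1 : Tendsto (fun t : ℝ => Real.exp (-(m * t))) atTop (𝓝 0) :=
      Real.tendsto_exp_neg_atTop_nhds_zero.comp (tendsto_id.const_mul_atTop hm)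
    simpa using h1.mul_const ‖ψ‖
  have h1 := integral_Ioi_of_hasDerivAt_of_tendsto (a := 0) (hd 0).continuousAt.continuousWithinAt
    (fun t _ => hd t) ((integrableOn_laplaceVec hU hm _ 0).smul Complex.I) hlim
  rw [integral_smul] at h1
  rw [laplaceVec, neg_smul, h1]
  simp [F, hU.map_zero_apply]

/-- Right inverse of `im - A`. Translating the integral `J` gives `U(s)J = e^{-ms}(∫_{-s}^0 F + J)`,
and the right side is differentiable in `s` for every vector `χ`. -/
lemma hasGen_laplaceVec (χ : H) :
    HasGen U (laplaceVec U m χ) ((Complex.I * (m : ℂ)) • laplaceVec U m χ - χ) := by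
  set F : ℝ → H := fun t => (Real.exp (-(m * t)) : ℂ) • U (-t) χ with hF
  have hFi := integrableOn_laplaceVec hU hm χ
  have hFc : Continuous F :=
    (by fun_prop : Continuous fun t : ℝ => (Real.exp (-(m * t)) : ℂ)).smul
      ((hU.continuous χ).comp continuous_neg)
  set J : H := ∫ t in Set.Ioi (0 : ℝ), F t with hJ
  have hshift : ∀ s : ℝ, U s J = (Real.exp (-(m * s)) : ℂ) • ((∫ t in (-s)..0, F t) + J) := by
    intro s
    rw [intervalIntegral.integral_interval_add_Ioi (hFi _) (hFi _)]
    rw [hJ, ← ContinuousLinearMap.integral_comp_comm (U s) (hFi 0)]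
    change ∫ t in Set.Ioi (0 : ℝ), U s (F t) = _
    have h1 : ∀ t, U s (F t) = (Real.exp (-(m * s)) : ℂ) • F (t - s) := by
      intro t
      simp only [hF, map_smul, ← hU.map_add_apply, smul_smul]
      congr 2
      · rw [← Complex.ofReal_mul, ← Real.exp_add]
        congr 2
        ring
      · ring_nf
    simp only [h1]
    rw [integral_smul]
    congr 1
    rw [← integral_indicator measurableSet_Ioi, ← integral_indicator measurableSet_Ioi,
      ← integral_sub_right_eq_self (Set.indicator (Set.Ioi (-s)) F) s]
    refine integral_congr_ae (Eventually.of_forall fun t => ?_)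
    simp [Set.indicator_apply]
  have hint : HasDerivAt (fun s : ℝ => ∫ t in (-s)..0, F t) χ 0 := by
    have h1 := intervalIntegral.integral_hasDerivAt_left (f := F) (a := -0) (b := 0)
      (hFc.intervalIntegrable _ _) (hFc.stronglyMeasurableAtFilter _ _) hFc.continuousAt
    have h2 := HasDerivAt.scomp (h := fun t : ℝ => -t) 0 h1 (hasDerivAt_neg 0)
    simpa [Function.comp_def, hF, hU.map_zero_apply] using h2
  have hexp : HasDerivAt (fun t : ℝ => (Real.exp (-(m * t)) : ℂ)) (-m : ℂ) 0 := by
    simpa using (hasDerivAt_const_mul_neg m 0).exp.ofReal_comp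
  have hder := hexp.smul (hint.add_const J)
  have hG : HasGen U J (Complex.I • (m : ℂ) • J - Complex.I • χ) := by
    have : HasDerivAt (fun s => U s J) (χ - (m : ℂ) • J) 0 := by
      refine (hder.congr_of_eventuallyEq (Eventually.of_forall hshift)).congr_deriv ?_
      simp [sub_eq_add_neg]
    refine this.congr_deriv ?_
    simp only [smul_sub, smul_smul, ← mul_assoc, Complex.I_mul_I]
    simp [sub_eq_add_neg, add_comm]
  have h2 := hG.smul (-Complex.I)
  change HasGen U (-Complex.I • J) ((Complex.I * (m : ℂ)) • -Complex.I • J - χ)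
  convert h2 using 1
  simp only [smul_sub, smul_smul, neg_mul, Complex.I_mul_I]
  simp
  ring_nf

lemma hasGen_iff_laplaceVec {ψ φ : H} :
    HasGen U ψ φ ↔ laplaceVec U m ((Complex.I * (m : ℂ)) • ψ - φ) = ψ := by
  refine ⟨laplaceVec_of_hasGen hU hm, fun h => ?_⟩
  have h1 := hasGen_laplaceVec hU hm ((Complex.I * (m : ℂ)) • ψ - φ)
  rw [h] at h1
  simpa using h1

end Laplace

end UnitaryGroups

/-! ### Operators given by their resolvents on the imaginary axis -/

section ResolventFamilies

variable {H : Type*} [NormedAddCommGroup H] [InnerProductSpace ℂ H] [CompleteSpace H]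

/-- `r l = (il - A)⁻¹`, `l ≠ 0`, are the resolvents of the operator `A` on the imaginary axis. -/
structure IsResolventFamily (A : H →ₗ.[ℂ] H) (r : ℝ → H →L[ℂ] H) : Prop where
  star_eq : ∀ l, star (r l) = r (-l)
  norm_le : ∀ l, ‖r l‖ ≤ |l|⁻¹
  sub_eq : ∀ l m, l ≠ 0 → m ≠ 0 → r l - r m = (Complex.I * ((m : ℂ) - l)) • (r l * r m)
  mem_graph_one : ∀ ψ φ, (ψ, φ) ∈ A.graph ↔ r 1 (Complex.I • ψ - φ) = ψ

namespace IsResolventFamily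

variable {A : H →ₗ.[ℂ] H} {r : ℝ → H →L[ℂ] H} (h : IsResolventFamily A r)
include h

lemma apply_sub (l m : ℝ) (hl : l ≠ 0) (hm : m ≠ 0) (χ : H) :
    r l χ - r m χ = (Complex.I * ((m : ℂ) - l)) • r l (r m χ) :=
  congrArg (fun T : H →L[ℂ] H => T χ) (h.sub_eq l m hl hm)

lemma inner_apply (l : ℝ) (ψ φ : H) : ⟪r l ψ, φ⟫_ℂ = ⟪ψ, r (-l) φ⟫_ℂ := by
  rw [← h.star_eq, ContinuousLinearMap.star_eq_adjoint, ContinuousLinearMap.adjoint_inner_right]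

/-- The resolvent identity carries the graph condition from one point of the axis to any other, so
the axiom at `1` suffices. -/
lemma mem_graph_iff_of_mem {l m : ℝ} (hl : l ≠ 0) (hm : m ≠ 0) {ψ φ : H}
    (hψ : r m ((Complex.I * (m : ℂ)) • ψ - φ) = ψ) : r l ((Complex.I * (l : ℂ)) • ψ - φ) = ψ := by
  set χ := (Complex.I * (m : ℂ)) • ψ - φ with hχ
  have h1 : (Complex.I * (l : ℂ)) • ψ - φ = χ + (Complex.I * ((l : ℂ) - m)) • r m χ := by
    rw [hψ, hχ]; module
  have h2 := h.apply_sub l m hl hm χ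
  rw [h1, map_add, map_smul, ← hψ]
  linear_combination (norm := module) h2

lemma mem_graph_iff {l : ℝ} (hl : l ≠ 0) {ψ φ : H} :
    (ψ, φ) ∈ A.graph ↔ r l ((Complex.I * (l : ℂ)) • ψ - φ) = ψ := by
  have h1 : (ψ, φ) ∈ A.graph ↔ r 1 ((Complex.I * ((1 : ℝ) : ℂ)) • ψ - φ) = ψ := by
    rw [h.mem_graph_one, Complex.ofReal_one, mul_one]
  rw [h1]
  exact ⟨h.mem_graph_iff_of_mem hl one_ne_zero, h.mem_graph_iff_of_mem one_ne_zero hl⟩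

lemma apply_mem_graph {l : ℝ} (hl : l ≠ 0) (χ : H) :
    (r l χ, (Complex.I * (l : ℂ)) • r l χ - χ) ∈ A.graph := by
  rw [h.mem_graph_iff hl, sub_sub_cancel]

lemma one_apply_mem_graph (χ : H) : (r 1 χ, Complex.I • r 1 χ - χ) ∈ A.graph := by
  rw [h.mem_graph_one, sub_sub_cancel]

/-- Otherwise the graph of `A` would contain `(0, -χ)` with `χ ≠ 0`. -/
lemma eq_zero_of_apply {l : ℝ} (hl : l ≠ 0) {χ : H} (hχ : r l χ = 0) : χ = 0 := by
  have h1 := h.apply_mem_graph hl χ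
  rw [hχ, smul_zero, zero_sub] at h1
  exact neg_eq_zero.mp (A.graph_fst_eq_zero_snd h1 rfl)

lemma apply_comm (l m : ℝ) (hl : l ≠ 0) (hm : m ≠ 0) (χ : H) : r l (r m χ) = r m (r l χ) := by
  rcases eq_or_ne l m with rfl | hlm
  · rfl
  have h1 := h.apply_sub l m hl hm χ
  have h2 := h.apply_sub m l hm hl χ
  have h3 : (Complex.I * ((m : ℂ) - l)) • (r l (r m χ) - r m (r l χ)) = 0 := by
    linear_combination (norm := module) -h1 - h2
  rcases smul_eq_zero.mp h3 with h4 | h4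
  · rcases mul_eq_zero.mp h4 with h5 | h5
    · exact absurd h5 Complex.I_ne_zero
    · exact absurd (by exact_mod_cast (sub_eq_zero.mp h5).symm) hlm
  · exact sub_eq_zero.mp h4

lemma mem_domain_iff {ψ : H} : ψ ∈ A.domain ↔ ∃ χ, r 1 χ = ψ := by
  rw [LinearPMap.mem_domain_iff]
  constructor
  · rintro ⟨φ, hφ⟩
    exact ⟨_, (h.mem_graph_one _ _).mp hφ⟩
  · rintro ⟨χ, rfl⟩
    exact ⟨_, h.one_apply_mem_graph χ⟩

lemma apply_mem_domain {l : ℝ} (hl : l ≠ 0) (χ : H) : r l χ ∈ A.domain :=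
  LinearPMap.mem_domain_iff.mpr ⟨_, h.apply_mem_graph hl χ⟩

/-- The orthogonal complement of the range is the kernel of the adjoint `r (-l)`, which is
injective. -/
lemma denseRange {l : ℝ} (hl : l ≠ 0) : DenseRange (r l) := by
  have h1 : (LinearMap.range (r l : H →ₗ[ℂ] H))ᗮ = ⊥ := by
    rw [ContinuousLinearMap.orthogonal_range, ← ContinuousLinearMap.star_eq_adjoint, h.star_eq,
      LinearMap.ker_eq_bot']
    exact fun χ hχ => h.eq_zero_of_apply (neg_ne_zero.mpr hl) hχ
  rw [← Submodule.topologicalClosure_eq_top_iff,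
    ← Submodule.dense_iff_topologicalClosure_eq_top] at h1
  exact h1

lemma dense_domain : Dense (A.domain : Set H) := by
  refine (h.denseRange one_ne_zero).mono ?_
  rintro _ ⟨χ, rfl⟩
  exact h.apply_mem_domain one_ne_zero χ

lemma inner_graph {ψ φ ψ' φ' : H} (hψ : (ψ, φ) ∈ A.graph) (hψ' : (ψ', φ') ∈ A.graph) :
    ⟪φ, ψ'⟫_ℂ = ⟪ψ, φ'⟫_ℂ := by
  rw [h.mem_graph_one] at hψ
  have h2 := (h.mem_graph_iff (l := -1) (by norm_num)).mp hψ'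
  have h3 := h.inner_apply 1 (Complex.I • ψ - φ) ((Complex.I * ((-1 : ℝ) : ℂ)) • ψ' - φ')
  rw [hψ, h2] at h3
  simp only [inner_sub_left, inner_sub_right, inner_smul_left, inner_smul_right, Complex.conj_I]
    at h3
  push_cast at h3
  linear_combination h3

lemma isSelfAdjoint : IsSelfAdjoint A := by
  rw [LinearPMap.isSelfAdjoint_def]
  have hle : A ≤ A.adjoint := by
    refine LinearPMap.IsFormalAdjoint.le_adjoint h.dense_domain fun x y => ?_
    exact h.inner_graph (A.mem_graph x) (A.mem_graph y)
  refine (LinearPMap.eq_of_le_of_domain_eq hle (le_antisymm hle.1 fun y hy => ?_)).symm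
  set w := A.adjoint ⟨y, hy⟩
  -- Here `-(w + iy)` is `(-i - A⋆)y`. Pairing with `x` moves `r (-1)` to `r 1 x`, a vector of `Dom
  -- A`, where the definition of `A⋆` applies. So `y` lies in the range of `(-i - A)⁻¹`.
  have hw : y = r (-1) (-(w + Complex.I • y)) := by
    refine ext_inner_right ℂ fun x => ?_
    have h1 := h.one_apply_mem_graph x
    obtain ⟨d, hd1, hd2⟩ := (A.mem_graph_iff).mp h1
    have h2 : ⟪w, (d : H)⟫_ℂ = ⟪y, A d⟫_ℂ :=
      LinearPMap.adjoint_isFormalAdjoint h.dense_domain ⟨y, hy⟩ d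
    rw [hd2, show (d : H) = r 1 x from hd1] at h2
    rw [h.inner_apply, neg_neg, inner_neg_left, inner_add_left, inner_smul_left, Complex.conj_I, h2,
      inner_sub_right, inner_smul_right]
    ring
  rw [hw]
  exact h.apply_mem_domain (by norm_num) _

lemma norm_smul_apply_le (l : ℝ) (χ : H) : ‖(Complex.I * (l : ℂ)) • r l χ‖ ≤ ‖χ‖ := by
  rw [norm_smul, norm_mul, Complex.norm_I, one_mul, Complex.norm_real, Real.norm_eq_abs]
  refine (mul_le_mul_of_nonneg_left ((r l).le_of_opNorm_le (h.norm_le l) χ) (abs_nonneg l)).trans ?_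
  rcases eq_or_ne l 0 with rfl | hl
  · simp
  · rw [← mul_assoc, mul_inv_cancel₀ (abs_ne_zero.mpr hl), one_mul]

/-- On the dense range of `r 1` the resolvent identity bounds the error by `|u|⁻¹ ‖A r(1)χ‖`; the
bound `‖u r(u)‖ ≤ 1` extends the limit to all vectors. Only `|u| → ∞` is required, which serves both
signs and the limit `s → 0`. -/
lemma tendsto_smul_apply {ι : Type*} {F : Filter ι} {u : ι → ℝ}
    (hu : Tendsto (fun i => |u i|) F atTop) (ψ : H) :
    Tendsto (fun i => (Complex.I * (u i : ℂ)) • r (u i) ψ) F (𝓝 ψ) := by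
  have hdom : ∀ χ, Tendsto (fun i => (Complex.I * (u i : ℂ)) • r (u i) (r 1 χ)) F (𝓝 (r 1 χ)) := by
    intro χ
    rw [tendsto_iff_norm_sub_tendsto_zero]
    have hlim : Tendsto (fun i => |u i|⁻¹ * ‖Complex.I • r 1 χ - χ‖) F (𝓝 0) := by
      simpa using (tendsto_inv_atTop_zero.comp hu).mul_const ‖Complex.I • r 1 χ - χ‖
    refine squeeze_zero' (Eventually.of_forall fun i => norm_nonneg _) ?_ hlim
    filter_upwards [hu.eventually_gt_atTop 0] with i hi
    have h1 := h.apply_sub (u i) 1 (abs_pos.mp hi) one_ne_zero χ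
    have h2 : (Complex.I * (u i : ℂ)) • r (u i) (r 1 χ) - r 1 χ =
        r (u i) (Complex.I • r 1 χ - χ) := by
      rw [map_sub, map_smul]
      push_cast at h1
      linear_combination (norm := module) h1
    rw [h2]
    exact (r (u i)).le_of_opNorm_le (h.norm_le _) _
  rw [Metric.tendsto_nhds]
  intro ε hε
  obtain ⟨χ, hχ⟩ := (h.denseRange one_ne_zero).exists_dist_lt ψ (ε := ε / 3) (by positivity)
  filter_upwards [Metric.tendsto_nhds.mp (hdom χ) (ε / 3) (by positivity)] with i hi
  have h1 := h.norm_smul_apply_le (u i) (ψ - r 1 χ)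
  rw [map_sub, smul_sub, ← dist_eq_norm, ← dist_eq_norm] at h1
  have h3 := dist_triangle4 ((Complex.I * (u i : ℂ)) • r (u i) ψ)
    ((Complex.I * (u i : ℂ)) • r (u i) (r 1 χ)) (r 1 χ) ψ
  rw [dist_comm (r 1 χ) ψ] at h3
  linarith

/-- A self-adjoint bounded approximation `A n² (n² + A²)⁻¹` of `A`. -/
def _root_.ResolventAlgebra.yosida (r : ℝ → H →L[ℂ] H) (n : ℕ) : H →L[ℂ] H :=
  (-((n : ℂ) ^ 2 / 2)) • (r n + r (-n))

lemma isSelfAdjoint_yosida (n : ℕ) : IsSelfAdjoint (yosida r n) := by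
  rw [IsSelfAdjoint, yosida, star_smul, star_add, h.star_eq, h.star_eq, neg_neg, add_comm]
  simp

lemma commute_yosida (m n : ℕ) : Commute (yosida r m) (yosida r n) := by
  -- The resolvent identity is silent about `r 0`, but at index `0` the prefactor vanishes.
  rcases eq_or_ne m 0 with rfl | hm
  · simp [yosida]
  rcases eq_or_ne n 0 with rfl | hn
  · simp [yosida]
  have hm' : (m : ℝ) ≠ 0 := Nat.cast_ne_zero.mpr hm
  have hn' : (n : ℝ) ≠ 0 := Nat.cast_ne_zero.mpr hn
  have key : ∀ a b : ℝ, a ≠ 0 → b ≠ 0 → Commute (r a) (r b) := fun a b ha hb =>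
    ContinuousLinearMap.ext fun χ => h.apply_comm a b ha hb χ
  refine Commute.smul_left (Commute.smul_right ?_ _) _
  exact Commute.add_left
    (Commute.add_right (key _ _ hm' hn') (key _ _ hm' (neg_ne_zero.mpr hn')))
    (Commute.add_right (key _ _ (neg_ne_zero.mpr hm') hn')
      (key _ _ (neg_ne_zero.mpr hm') (neg_ne_zero.mpr hn')))

/-- For large `n` the approximant at `ψ` is `(in r(n))(-in r(-n))φ`, and both factors tend strongly
to `1`. -/
lemma tendsto_yosida {ψ φ : H} (hψ : (ψ, φ) ∈ A.graph) :
    Tendsto (fun n => yosida r n ψ) atTop (𝓝 φ) := by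
  have hn : Tendsto (fun n : ℕ => |(n : ℝ)|) atTop atTop := by
    simpa using tendsto_natCast_atTop_atTop (R := ℝ)
  have hn' : Tendsto (fun n : ℕ => |(-n : ℝ)|) atTop atTop := by simpa using hn
  have h1 := h.tendsto_smul_apply hn φ
  have h2 := h.tendsto_smul_apply hn' φ
  have h3 : Tendsto (fun n : ℕ => (Complex.I * ((n : ℝ) : ℂ)) •
      r n ((Complex.I * ((-n : ℝ) : ℂ)) • r (-n) φ)) atTop (𝓝 φ) := by
    have h4 : Tendsto (fun n : ℕ => (Complex.I * ((n : ℝ) : ℂ)) •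
        r n ((Complex.I * ((-n : ℝ) : ℂ)) • r (-n) φ - φ)) atTop (𝓝 0) := by
      rw [tendsto_iff_norm_sub_tendsto_zero] at h2
      rw [tendsto_zero_iff_norm_tendsto_zero]
      exact squeeze_zero (fun _ => norm_nonneg _) (fun n => h.norm_smul_apply_le n _) h2
    have h5 := h4.add h1
    rw [zero_add] at h5
    refine h5.congr fun n => ?_
    rw [map_sub, smul_sub, sub_add_cancel]
  refine h3.congr' ?_
  filter_upwards [eventually_ne_atTop 0] with n hn0
  have hl : (n : ℝ) ≠ 0 := Nat.cast_ne_zero.mpr hn0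
  have e1 := (h.mem_graph_iff hl).mp hψ
  have e2 := (h.mem_graph_iff (neg_ne_zero.mpr hl)).mp hψ
  have e3 := congrArg (r (-n)) e1
  have e4 := congrArg (r n) e2
  have e5 := h.apply_comm n (-n) hl (neg_ne_zero.mpr hl)
  simp only [map_sub, map_smul] at e3 e4 ⊢
  rw [← e5 ψ, ← e5 φ] at e3
  simp only [yosida, _root_.smul_apply, _root_.add_apply]
  push_cast
  push_cast at e3 e4
  linear_combination (norm := module) (-((n : ℂ) ^ 2 / 2)) • e3 - ((n : ℂ) ^ 2 / 2) • e4 +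
    Complex.I_sq • (-((n : ℂ) ^ 2) • r n (r (-n) φ))

end IsResolventFamily

end ResolventFamilies

/-! ### Stone's theorem and integrated commutation relations -/

section Stone

set_option synthInstance.maxHeartbeats 200000

variable {H : Type*} [NormedAddCommGroup H] [InnerProductSpace ℂ H] [CompleteSpace H]

/-- The unitary group `exp(itB)` of a bounded selfadjoint operator. -/
def expGroup (B : selfAdjoint (H →L[ℂ] H)) (t : ℝ) : H →L[ℂ] H :=
  selfAdjoint.expUnitary (t • B)

lemma hasDerivAt_expGroup (B : selfAdjoint (H →L[ℂ] H)) (t : ℝ) :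
    HasDerivAt (expGroup B) (expGroup B t * (Complex.I • (B : H →L[ℂ] H))) t := by
  have h := hasDerivAt_exp_smul_const (𝕂 := ℝ) (Complex.I • (B : H →L[ℂ] H)) t
  have e : ∀ t : ℝ, expGroup B t = NormedSpace.exp (t • (Complex.I • (B : H →L[ℂ] H))) := by
    intro t
    rw [expGroup, selfAdjoint.expUnitary_coe, selfAdjoint.val_smul, smul_comm]
  rw [e t]
  exact h.congr_of_eventuallyEq (Eventually.of_forall e)

lemma isUnitaryGroup_expGroup (B : selfAdjoint (H →L[ℂ] H)) : IsUnitaryGroup (expGroup B) where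
  mem_unitary t := (selfAdjoint.expUnitary (t • B)).2
  map_add s t := by
    have hc : Commute ((s • B : selfAdjoint (H →L[ℂ] H)) : H →L[ℂ] H)
        ((t • B : selfAdjoint (H →L[ℂ] H)) : H →L[ℂ] H) := by
      rw [selfAdjoint.val_smul, selfAdjoint.val_smul]
      exact ((Commute.refl _).smul_left _).smul_right _
    have : (s + t) • B = s • B + t • B := Subtype.ext (add_smul s t (B : H →L[ℂ] H))
    rw [expGroup, this, hc.expUnitary_add]
    rfl
  continuous ψ := by
    have : Continuous (expGroup B) :=
      continuous_iff_continuousAt.mpr fun t => (hasDerivAt_expGroup B t).continuousAt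
    exact this.clm_apply continuous_const

lemma hasGen_expGroup (B : selfAdjoint (H →L[ℂ] H)) (ψ : H) :
    HasGen (expGroup B) ψ ((B : H →L[ℂ] H) ψ) := by
  have h := hasDerivAt_expGroup B 0
  rw [(isUnitaryGroup_expGroup B).map_zero, one_mul] at h
  have h1 := (ContinuousLinearMap.apply ℂ H ψ).restrictScalars ℝ |>.hasFDerivAt.comp_hasDerivAt 0 h
  exact h1

namespace IsUnitaryGroup

variable {U : ℝ → H →L[ℂ] H} (hU : IsUnitaryGroup U)
include hU

lemma norm_sub_le {ψ φ : H} (h : HasGen U ψ φ) (t : ℝ) : ‖U t ψ - ψ‖ ≤ ‖φ‖ * |t| := by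
  have h1 := convex_univ.norm_image_sub_le_of_norm_hasDerivWithin_le (x := (0 : ℝ)) (y := t)
    (fun s _ => (h.hasDerivAt hU s).hasDerivWithinAt) (C := ‖φ‖)
    (fun s _ => by rw [norm_smul, Complex.norm_I, one_mul, hU.norm_map]) trivial trivial
  rwa [hU.map_zero_apply, sub_zero, Real.norm_eq_abs] at h1

/-- Mean value inequality: the derivative in question is `i(U(s)φ - φ)`, estimated by replacing `φ`
with `η` from the domain. The bound sees the group only through `φ`, `η`, `ξ`, so it survives the
limit of the Yosida groups. -/
lemma norm_sub_sub_le {ψ φ η ξ : H} (h : HasGen U ψ φ) (hη : HasGen U η ξ) (t : ℝ) :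
    ‖U t ψ - ψ - (t * Complex.I) • φ‖ ≤ (2 * ‖φ - η‖ + ‖ξ‖ * |t|) * |t| := by
  have h1 : ∀ s, HasDerivAt (fun t : ℝ => U t ψ - ((t : ℂ) * Complex.I) • φ)
      (Complex.I • (U s φ - φ)) s := by
    intro s
    have h2 : HasDerivAt (fun t : ℝ => (t : ℂ) * Complex.I) Complex.I s := by
      simpa using (hasDerivAt_id s).ofReal_comp.mul_const Complex.I
    rw [smul_sub]
    exact (h.hasDerivAt hU s).sub (h2.smul_const φ)
  have h3 := (convex_Icc (-|t|) |t|).norm_image_sub_le_of_norm_hasDerivWithin_le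
    (x := (0 : ℝ)) (y := t) (fun s _ => (h1 s).hasDerivWithinAt)
    (C := 2 * ‖φ - η‖ + ‖ξ‖ * |t|) (fun s hs => ?_) (by simp) (Set.mem_Icc.mpr (abs_le.mp le_rfl))
  · simp only [hU.map_zero_apply, sub_zero, Real.norm_eq_abs, Complex.ofReal_zero, zero_mul,
      zero_smul] at h3
    rwa [sub_right_comm]
  · rw [norm_smul, Complex.norm_I, one_mul]
    have h4 : U s φ - φ = U s (φ - η) + (U s η - η) - (φ - η) := by rw [map_sub]; abel
    have h5 := (_root_.norm_sub_le (U s (φ - η) + (U s η - η)) (φ - η))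
    have h6 := norm_add_le (U s (φ - η)) (U s η - η)
    have h7 := hU.norm_sub_le hη s
    rw [hU.norm_map] at h6
    have h8 : ‖ξ‖ * |s| ≤ ‖ξ‖ * |t| :=
      mul_le_mul_of_nonneg_left (abs_le.mpr hs) (norm_nonneg _)
    rw [h4]
    linarith

end IsUnitaryGroup

/-- Isometric actions of `ℝ` that are strongly continuous on a dense set are unitary groups. -/
lemma isUnitaryGroup_of_norm_map {U : ℝ → H →L[ℂ] H} (h0 : ∀ ψ, U 0 ψ = ψ)
    (hadd : ∀ s t ψ, U (s + t) ψ = U s (U t ψ)) (hnorm : ∀ t ψ, ‖U t ψ‖ = ‖ψ‖)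
    {S : Set H} (hS : Dense S) (hc : ∀ ψ ∈ S, Continuous fun t => U t ψ) : IsUnitaryGroup U where
  mem_unitary t := by
    have h1 : ∀ t, star (U t) * U t = 1 := fun t =>
      (ContinuousLinearMap.norm_map_iff_adjoint_comp_self (U t)).mp (hnorm t)
    have h2 : U t * U (-t) = 1 := by
      ext ψ
      rw [mul_apply_eq_comp, ← hadd, add_neg_cancel, h0, one_apply_eq_self]
    have h3 : star (U t) = U (-t) := by
      calc star (U t) = star (U t) * (U t * U (-t)) := by rw [h2, mul_one]
        _ = U (-t) := by rw [← mul_assoc, h1, one_mul]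
    exact Unitary.mem_iff.mpr ⟨h1 t, by rw [h3, h2]⟩
  map_add s t := ContinuousLinearMap.ext fun ψ => hadd s t ψ
  continuous ψ := by
    refine continuous_of_uniform_approx_of_continuous fun u hu => ?_
    obtain ⟨ε, hε, hεu⟩ := Metric.mem_uniformity_dist.mp hu
    obtain ⟨φ, hφ, hd⟩ := Metric.dense_iff.mp hS ψ ε hε
    refine ⟨fun t => U t φ, hc φ hd, fun t => hεu ?_⟩
    rw [dist_eq_norm, ← map_sub, hnorm, ← dist_eq_norm, dist_comm]
    exact Metric.mem_ball.mp hφ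

/-- Since `B` and `C` commute, `exp(itB) = exp(itC) exp(it(B - C))`, and the isometry `exp(itC)`
drops out of the norm. -/
lemma norm_expGroup_sub_le {B C : selfAdjoint (H →L[ℂ] H)}
    (hc : Commute (B : H →L[ℂ] H) (C : H →L[ℂ] H)) (t : ℝ) (ψ : H) :
    ‖expGroup B t ψ - expGroup C t ψ‖ ≤ ‖(B : H →L[ℂ] H) ψ - (C : H →L[ℂ] H) ψ‖ * |t| := by
  have hc' : Commute ((t • C : selfAdjoint (H →L[ℂ] H)) : H →L[ℂ] H)
      ((t • (B - C) : selfAdjoint (H →L[ℂ] H)) : H →L[ℂ] H) := by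
    rw [selfAdjoint.val_smul, selfAdjoint.val_smul]
    refine Commute.smul_left (Commute.smul_right ?_ _) _
    exact hc.symm.sub_right (Commute.refl _)
  have h1 : expGroup B t ψ = expGroup C t (expGroup (B - C) t ψ) := by
    have : t • B = t • C + t • (B - C) := Subtype.ext (by
      change t • (B : H →L[ℂ] H) = t • (C : H →L[ℂ] H) + t • ((B : H →L[ℂ] H) - C)
      rw [← smul_add, add_sub_cancel])
    rw [expGroup, this, hc'.expUnitary_add]
    rfl
  rw [h1, ← map_sub, (isUnitaryGroup_expGroup C).norm_map]
  exact (isUnitaryGroup_expGroup (B - C)).norm_sub_le (hasGen_expGroup (B - C) ψ) t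

/-- An operator with resolvents on the imaginary axis generates a unitary group. -/
theorem IsResolventFamily.exists_isUnitaryGroupOf {A : H →ₗ.[ℂ] H} {r : ℝ → H →L[ℂ] H}
    (h : IsResolventFamily A r) : ∃ U, IsUnitaryGroupOf A U := by
  set B : ℕ → selfAdjoint (H →L[ℂ] H) := fun n => ⟨yosida r n, h.isSelfAdjoint_yosida n⟩ with hB
  have hE := fun n => isUnitaryGroup_expGroup (B n)
  have hlim : ∀ t ψ, ∃ φ, Tendsto (fun n => expGroup (B n) t ψ) atTop (𝓝 φ) := by
    intro t ψ
    refine cauchySeq_tendsto_of_complete (Metric.cauchySeq_iff'.mpr fun ε hε => ?_)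
    obtain ⟨η, hη, hη'⟩ := Metric.dense_iff.mp h.dense_domain ψ (ε / 3) (by positivity)
    obtain ⟨ξ, hξ⟩ := LinearPMap.mem_domain_iff.mp hη'
    obtain ⟨N, hN⟩ := Metric.cauchySeq_iff'.mp (h.tendsto_yosida hξ).cauchySeq
      (ε / 3 / (|t| + 1)) (by positivity)
    refine ⟨N, fun n hn => ?_⟩
    have h1 := norm_expGroup_sub_le (h.commute_yosida n N) (B := B n) (C := B N) t η
    have h2 := hN n hn
    rw [dist_eq_norm] at h2
    have h3 : ‖yosida r n η - yosida r N η‖ * |t| < ε / 3 := by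
      calc _ ≤ ‖yosida r n η - yosida r N η‖ * (|t| + 1) := by gcongr; linarith
        _ < ε / 3 := by rwa [lt_div_iff₀ (by positivity)] at h2
    have h4 : ∀ k, dist (expGroup (B k) t ψ) (expGroup (B k) t η) < ε / 3 := fun k => by
      rw [dist_eq_norm, ← map_sub, (hE k).norm_map, ← dist_eq_norm, dist_comm]
      exact Metric.mem_ball.mp hη
    have h5 := dist_triangle4 (expGroup (B n) t ψ) (expGroup (B n) t η) (expGroup (B N) t η)
      (expGroup (B N) t ψ)
    have h6 := h4 N
    rw [dist_comm] at h6
    rw [← dist_eq_norm] at h1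
    have h7 : dist (expGroup (B n) t η) (expGroup (B N) t η) < ε / 3 := h1.trans_lt h3
    linarith [h4 n]
  choose V hV using hlim
  set U : ℝ → H →L[ℂ] H := fun t =>
    continuousLinearMapOfTendsto (fun n => expGroup (B n) t) (tendsto_pi_nhds.mpr (hV t))
  have hU : ∀ t ψ, Tendsto (fun n => expGroup (B n) t ψ) atTop (𝓝 (U t ψ)) := hV
  have hUn : ∀ t ψ, ‖U t ψ‖ = ‖ψ‖ := fun t ψ =>
    tendsto_nhds_unique (hU t ψ).norm (by simp only [(hE _).norm_map]; exact tendsto_const_nhds)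
  have hU0 : ∀ ψ, U 0 ψ = ψ := fun ψ =>
    tendsto_nhds_unique (hU 0 ψ) (by simp only [(hE _).map_zero_apply]; exact tendsto_const_nhds)
  have hUadd : ∀ s t ψ, U (s + t) ψ = U s (U t ψ) := by
    intro s t ψ
    refine tendsto_nhds_unique (hU (s + t) ψ) ?_
    -- Strong limits pass to the product because the factors are isometries.
    have h1 : Tendsto (fun n => expGroup (B n) s (expGroup (B n) t ψ - U t ψ)) atTop (𝓝 0) := by
      rw [tendsto_zero_iff_norm_tendsto_zero]
      simp only [(hE _).norm_map]
      exact tendsto_iff_norm_sub_tendsto_zero.mp (hU t ψ)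
    have h2 := h1.add (hU s (U t ψ))
    rw [zero_add] at h2
    refine h2.congr fun n => ?_
    rw [map_sub, sub_add_cancel, (hE n).map_add_apply]
  have hlip : ∀ ψ φ, (ψ, φ) ∈ A.graph → ∀ t, ‖U t ψ - ψ‖ ≤ ‖φ‖ * |t| := fun ψ φ hψ t =>
    le_of_tendsto_of_tendsto' ((hU t ψ).sub_const ψ).norm
      ((h.tendsto_yosida hψ).norm.mul_const |t|)
      fun n => (hE n).norm_sub_le (hasGen_expGroup (B n) ψ) t
  have hgroup : IsUnitaryGroup U := by
    refine isUnitaryGroup_of_norm_map hU0 hUadd hUn h.dense_domain fun ψ hψ => ?_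
    obtain ⟨φ, hφ⟩ := LinearPMap.mem_domain_iff.mp hψ
    refine (LipschitzWith.of_dist_le_mul (K := ‖φ‖₊) fun s t => ?_).continuous
    have h1 : U s ψ = U t (U (s - t) ψ) := by rw [← hUadd, add_sub_cancel]
    rw [h1, dist_eq_norm, ← map_sub, hUn, Real.dist_eq]
    exact hlip ψ φ hφ _
  have hgen : ∀ ψ φ, (ψ, φ) ∈ A.graph → HasGen U ψ φ := by
    intro ψ φ hψ
    rw [HasGen, hasDerivAt_iff_isLittleO, Asymptotics.isLittleO_iff]
    intro c hc
    -- In the bound of `norm_sub_sub_le` this contributes `2 · c/4`; the term `‖ξ‖|t|` takes the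
    -- other `c/2`.
    obtain ⟨η, hη, hη'⟩ := Metric.dense_iff.mp h.dense_domain φ (c / 4) (by positivity)
    obtain ⟨ξ, hξ⟩ := LinearPMap.mem_domain_iff.mp hη'
    have hev : ∀ᶠ t : ℝ in 𝓝 0, ‖ξ‖ * |t| < c / 2 := by
      have : Tendsto (fun t : ℝ => ‖ξ‖ * |t|) (𝓝 0) (𝓝 (‖ξ‖ * |0|)) :=
        (continuous_const.mul continuous_abs).tendsto 0
      rw [abs_zero, mul_zero] at this
      exact this.eventually_lt_const (by positivity)
    filter_upwards [hev] with t ht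
    have h1 : ‖U t ψ - ψ - (t * Complex.I) • φ‖ ≤ (2 * ‖φ - η‖ + ‖ξ‖ * |t|) * |t| := by
      refine le_of_tendsto_of_tendsto'
        (((hU t ψ).sub_const ψ).sub ((h.tendsto_yosida hψ).const_smul _)).norm
        ((((((h.tendsto_yosida hψ).sub_const η).norm.const_mul 2).add
          ((h.tendsto_yosida hξ).norm.mul_const |t|))).mul_const |t|) fun n => ?_
      exact (hE n).norm_sub_sub_le (hasGen_expGroup (B n) ψ) (hasGen_expGroup (B n) η) t
    have h2 : ‖φ - η‖ < c / 4 := by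
      rw [← dist_eq_norm, dist_comm]; exact Metric.mem_ball.mp hη
    have h3 : (t - 0) • (Complex.I • φ) = ((t : ℂ) * Complex.I) • φ := by
      rw [sub_zero, mul_smul, Complex.coe_smul]
    rw [hU0, h3, sub_zero, Real.norm_eq_abs]
    refine h1.trans (mul_le_mul_of_nonneg_right ?_ (abs_nonneg t))
    linarith
  refine ⟨U, hgroup.1, hgroup.2, hgroup.3, fun ψ φ => ⟨hgen ψ φ, fun hψ => ?_⟩⟩
  -- The generator is no larger than `A`: the difference of `ψ` and `r 1 (iψ - φ)` is an eigenvector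
  -- of the generator for `i`, hence zero.
  have h1 := hgen _ _ (h.one_apply_mem_graph (Complex.I • ψ - φ))
  have h2 := HasGen.sub hψ h1
  have h3 : HasGen U (ψ - r 1 (Complex.I • ψ - φ))
      ((Complex.I * ((1 : ℝ) : ℂ)) • (ψ - r 1 (Complex.I • ψ - φ))) := by
    have e : (Complex.I * ((1 : ℝ) : ℂ)) • (ψ - r 1 (Complex.I • ψ - φ)) =
        φ - (Complex.I • r 1 (Complex.I • ψ - φ) - (Complex.I • ψ - φ)) := by
      push_cast
      module
    rw [e]
    exact h2
  rw [h.mem_graph_one]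
  exact (sub_eq_zero.mp (h3.eq_zero hgroup one_ne_zero)).symm

lemma IsResolventFamily.dense_hasGen {A : H →ₗ.[ℂ] H} {r : ℝ → H →L[ℂ] H}
    (h : IsResolventFamily A r) {U : ℝ → H →L[ℂ] H} (hU : IsUnitaryGroupOf A U) :
    Dense {ψ | ∃ φ, HasGen U ψ φ} := by
  refine h.dense_domain.mono fun ψ hψ => ?_
  obtain ⟨φ, hφ⟩ := LinearPMap.mem_domain_iff.mp hψ
  exact ⟨φ, (hU.generator ψ φ).mp hφ⟩

theorem IsResolventFamily.existsUnique_isUnitaryGroupOf {A : H →ₗ.[ℂ] H} {r : ℝ → H →L[ℂ] H}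
    (h : IsResolventFamily A r) : ∃! U, IsUnitaryGroupOf A U := by
  obtain ⟨U, hU⟩ := h.exists_isUnitaryGroupOf
  refine ⟨U, hU, fun V hV => ?_⟩
  exact hV.isUnitaryGroup.ext_of_hasGen hU.isUnitaryGroup (h.dense_hasGen hV)
    fun ψ φ hψ => (hU.generator ψ φ).mp ((hV.generator ψ φ).mpr hψ)

lemma expI_spec {A : H →ₗ.[ℂ] H} (h : ∃ U, IsUnitaryGroupOf A U) :
    ∃ U, IsUnitaryGroupOf A U ∧ expI A = U 1 :=
  ⟨h.choose, h.choose_spec, by rw [expI, dif_pos h]⟩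

/-- If the commutator of the generator of `U` with `S` is `icS²`, then
`U(1)SU(1)⋆ = S(1 + cS)⁻¹`. -/
theorem IsUnitaryGroup.intertwine {U : ℝ → H →L[ℂ] H} (hU : IsUnitaryGroup U)
    (hd : Dense {ψ | ∃ φ, HasGen U ψ φ}) (S : H →L[ℂ] H) (c : ℝ)
    (hS : ∀ ψ φ, HasGen U ψ φ → HasGen U (S ψ) (S φ + (Complex.I * (c : ℂ)) • S (S ψ))) (χ : H) :
    U 1 (S χ) = S (U 1 χ) - (c : ℂ) • S (U 1 (S χ)) := by
  refine congrFun (Continuous.ext_on hd (f := fun χ => U 1 (S χ))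
    (g := fun χ => S (U 1 χ) - (c : ℂ) • S (U 1 (S χ))) (by fun_prop) (by fun_prop) ?_) χ
  rintro ψ ⟨φ, hψ⟩
  -- The defect of the claim at time `s`, with `c` replaced by `sc`. It solves `X' = iAX + cSX` with
  -- `X(0) = 0`, `A` being the generator. The term `iAX` drops out of the derivative of `‖X‖²`, so
  -- Gronwall's inequality forces `X = 0`.
  set X : ℝ → H := fun s => U s (S ψ) - S (U s ψ) + (s * (c : ℂ)) • S (U s (S ψ)) with hX
  have hder : ∀ s, ∃ e, HasGen U (X s) e ∧
      HasDerivAt X (Complex.I • e + (c : ℂ) • S (X s)) s := by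
    intro s
    have g1 := (hS _ _ hψ).map hU s
    have g2 := hS _ _ (hψ.map hU s)
    have g3 := hS _ _ g1
    refine ⟨_, (g1.sub g2).add (g3.smul (s * (c : ℂ))), ?_⟩
    have d1 := (hS _ _ hψ).hasDerivAt hU s
    have d2 := hasDerivAt_clm_apply S (hψ.hasDerivAt hU s)
    have d3 := hasDerivAt_clm_apply S d1
    have d4 : HasDerivAt (fun s : ℝ => (s : ℂ) * c) (c : ℂ) s := by
      simpa using (hasDerivAt_id s).ofReal_comp.mul_const (c : ℂ)
    refine ((d1.sub d2).add (d4.smul d3)).congr_deriv ?_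
    simp only [map_smul, hX, _root_.map_add, map_sub]
    linear_combination (norm := module) Complex.I_sq • ((c : ℂ) • S (S (U s ψ)) -
      ((s : ℂ) * c ^ 2) • S (S (U s (S ψ))))
  choose e he hXd using hder
  have hn : ∀ s, HasDerivAt (fun s => ‖X s‖ ^ 2) (2 * (⟪X s, (c : ℂ) • S (X s)⟫_ℂ).re) s := by
    intro s
    have h1 := hasDerivAt_norm_sq (hXd s)
    rwa [inner_add_right, Complex.add_re, (he s).re_inner hU, zero_add] at h1
  have h1 := norm_le_gronwallBound_of_norm_deriv_right_le (f := fun s => ‖X s‖ ^ 2) (δ := 0)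
    (K := 2 * (|c| * ‖S‖)) (ε := 0) (a := 0) (b := 1)
    (fun s _ => (hn s).continuousAt.continuousWithinAt) (fun s _ => (hn s).hasDerivWithinAt)
    (by simp [hX, hU.map_zero_apply]) (fun s _ => ?_) 1 (by simp)
  · rw [gronwallBound_ε0_δ0] at h1
    have h2 : X 1 = 0 := by simpa using h1
    simp only [hX, Complex.ofReal_one, one_mul] at h2
    exact sub_eq_zero.mp (by rw [← h2, sub_sub_eq_add_sub, add_sub_right_comm])
  · rw [norm_mul, Real.norm_two, add_zero, mul_assoc]
    refine mul_le_mul_of_nonneg_left ?_ zero_le_two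
    rw [Real.norm_eq_abs, norm_pow, norm_norm]
    calc |(⟪X s, (c : ℂ) • S (X s)⟫_ℂ).re| ≤ ‖⟪X s, (c : ℂ) • S (X s)⟫_ℂ‖ :=
          Complex.abs_re_le_norm _
      _ ≤ ‖X s‖ * ‖(c : ℂ) • S (X s)‖ := norm_inner_le_norm _ _
      _ ≤ ‖X s‖ * (|c| * (‖S‖ * ‖X s‖)) := by
          rw [norm_smul, Complex.norm_real, Real.norm_eq_abs]
          gcongr
          exact S.le_opNorm _
      _ = |c| * ‖S‖ * ‖X s‖ ^ 2 := by ring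

/-- If `W` is unitary and shifts the generator of `V` by `c`, then
`V(t)W = exp(itc) W V(t)`. -/
theorem IsUnitaryGroup.weyl_relation {V : ℝ → H →L[ℂ] H} (hV : IsUnitaryGroup V)
    (hd : Dense {ψ | ∃ φ, HasGen V ψ φ}) {W : H →L[ℂ] H} (hW : W ∈ unitary (H →L[ℂ] H)) (c : ℝ)
    (h : ∀ ψ φ, HasGen V ψ φ → HasGen V (W ψ) (W φ + (c : ℂ) • W ψ)) (t : ℝ) :
    V t * W = Complex.exp (t * (Complex.I * c)) • (W * V t) := by
  obtain ⟨hW1, hW2⟩ := Unitary.mem_iff.mp hW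
  have hexp : ∀ t : ℝ, ‖Complex.exp (-(t * (Complex.I * c)))‖ = 1 := fun t => by
    rw [show -((t : ℂ) * (Complex.I * c)) = ((-(t * c) : ℝ) : ℂ) * Complex.I by push_cast; ring,
      Complex.norm_exp_ofReal_mul_I]
  have hexp' : ∀ s t : ℝ, Complex.exp (-(((s + t : ℝ) : ℂ) * (Complex.I * c))) =
      Complex.exp (-(s * (Complex.I * c))) * Complex.exp (-(t * (Complex.I * c))) := fun s t => by
    rw [← Complex.exp_add]; congr 1; push_cast; ring
  have hWs : ∀ ψ, W (star W ψ) = ψ := fun ψ => congrArg (fun T : H →L[ℂ] H => T ψ) hW2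
  have hsW : ∀ ψ, star W (W ψ) = ψ := fun ψ => congrArg (fun T : H →L[ℂ] H => T ψ) hW1
  have hWn := (ContinuousLinearMap.norm_map_iff_adjoint_comp_self W).mpr hW1
  have hWn' : ∀ ψ, ‖star W ψ‖ = ‖ψ‖ := fun ψ => by rw [← hWn, hWs]
  -- If `B` generates `V`, this group has generator `W⋆BW - c`. By hypothesis that operator extends
  -- `B`, so the two groups agree.
  set V' : ℝ → H →L[ℂ] H := fun t => Complex.exp (-(t * (Complex.I * c))) • (star W * V t * W)
  have happ : ∀ t ψ, V' t ψ = Complex.exp (-(t * (Complex.I * c))) • star W (V t (W ψ)) :=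
    fun _ _ => rfl
  have hcexp : Continuous fun t : ℝ => Complex.exp (-(t * (Complex.I * c))) := by fun_prop
  have hV' : IsUnitaryGroup V' := by
    refine isUnitaryGroup_of_norm_map (S := Set.univ) (fun ψ => ?_) (fun s t ψ => ?_)
      (fun t ψ => ?_) dense_univ fun ψ _ => ?_
    · rw [happ, hV.map_zero_apply, hsW]; simp
    · rw [happ, happ, happ, map_smul, map_smul, map_smul, hWs, hV.map_add_apply, hexp', smul_smul]
    · rw [happ, norm_smul, hexp, one_mul, hWn', hV.norm_map, hWn]
    · exact hcexp.smul ((star W).continuous.comp (hV.continuous _))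
  have hVV : V = V' := by
    refine hV.ext_of_hasGen hV' hd fun ψ φ hψ => ?_
    have d1 := hasDerivAt_clm_apply (star W) (h ψ φ hψ)
    have d2 : HasDerivAt (fun t : ℝ => Complex.exp (-(t * (Complex.I * c)))) (-(Complex.I * c))
        0 := by
      have := ((hasDerivAt_id (0 : ℝ)).ofReal_comp.mul_const (Complex.I * c)).fun_neg.cexp
      simpa using this
    refine (d2.smul d1).congr_deriv ?_
    simp only [map_smul, _root_.map_add, hsW, hV.map_zero_apply]
    simp only [Complex.ofReal_zero, zero_mul, neg_zero, Complex.exp_zero]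
    module
  refine ContinuousLinearMap.ext fun ψ => ?_
  have h1 : V t ψ = V' t ψ := congrArg (fun T : H →L[ℂ] H => T ψ) (congrFun hVV t)
  rw [mul_apply_eq_comp, _root_.smul_apply, mul_apply_eq_comp, h1, happ, map_smul, hWs, smul_smul,
    ← Complex.exp_add, add_neg_cancel, Complex.exp_zero, one_smul]

end Stone

/-! ### Differentiation along unitary groups -/

section Generators

set_option linter.unusedSectionVars false

variable {H : Type*} [NormedAddCommGroup H] [InnerProductSpace ℂ H] [CompleteSpace H]
  {U : ℝ → H →L[ℂ] H}

/-- The explicit factor `t` makes continuity of `F` enough. This is how terms outside the domain of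
a generator get differentiated. -/
lemma hasDerivAt_smul_of_continuousAt {F : ℝ → H} (hF : ContinuousAt F 0) :
    HasDerivAt (fun t => t • F t) (F 0) 0 := by
  rw [hasDerivAt_iff_tendsto_slope_zero]
  refine (hF.tendsto.mono_left nhdsWithin_le_nhds).congr' ?_
  filter_upwards [self_mem_nhdsWithin] with t ht
  have ht' : t ≠ 0 := ht
  rw [zero_add, zero_smul, sub_zero, smul_smul, inv_mul_cancel₀ ht', one_smul]

lemma HasGen.comp_mul (hU : IsUnitaryGroup U) {ψ φ : H} (h : HasGen U ψ φ) (l : ℝ) :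
    HasDerivAt (fun t => U (t * l) ψ) (Complex.I • (l : ℂ) • φ) 0 := by
  have h1 : HasDerivAt (fun t : ℝ => t * l) l 0 := by
    simpa using (hasDerivAt_id (0 : ℝ)).mul_const l
  have h2 := HasDerivAt.scomp (h := fun t : ℝ => t * l) 0 (h.hasDerivAt hU (0 * l)) h1
  rw [zero_mul, hU.map_zero_apply, ← Complex.coe_smul, smul_comm] at h2
  exact h2

/-- Write `w(t) = w(0) + tw' + o(t)`. The first term is in the domain, the second needs only strong
continuity, and the isometry keeps the remainder `o(t)`. -/
lemma HasGen.apply_curve (hU : IsUnitaryGroup U) {w : ℝ → H} {w' φ : H}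
    (h : HasGen U (w 0) φ) (hw : HasDerivAt w w' 0) (l : ℝ) :
    HasDerivAt (fun t => U (t * l) (w t)) (Complex.I • (l : ℂ) • φ + w') 0 := by
  have d1 := h.comp_mul hU l
  have d2 : HasDerivAt (fun t : ℝ => t • U (t * l) w') w' 0 := by
    have hc : Continuous fun t : ℝ => U (t * l) w' :=
      (hU.continuous w').comp (continuous_id.mul continuous_const)
    have := hasDerivAt_smul_of_continuousAt hc.continuousAt
    rwa [zero_mul, hU.map_zero_apply] at this
  have d3 : HasDerivAt (fun t : ℝ => U (t * l) (w t - w 0 - t • w')) 0 0 := by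
    rw [hasDerivAt_iff_isLittleO] at hw ⊢
    simp only [smul_zero, sub_zero, sub_self, zero_smul, map_zero] at hw ⊢
    refine hw.norm_left.congr_left (fun t => (hU.norm_map _ _).symm) |>.of_norm_left
  have d := (d1.add d2).add d3
  rw [add_zero] at d
  refine d.congr_of_eventuallyEq (Eventually.of_forall fun t => ?_)
  simp

lemma IsUnitaryGroup.continuous_smul_apply (hU : IsUnitaryGroup U) (S : H →L[ℂ] H) (c : ℂ) (ψ : H) :
    Continuous fun s => c • S (U s ψ) := by
  have h := hU.continuous ψ
  fun_prop

/-- Symmetry of the generator `A`, tested on `(im + A)⁻¹x` and `(im - A)⁻¹y`, identifies `-(im +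
A)⁻¹` as the adjoint of `(im - A)⁻¹`. -/
lemma inner_laplaceVec (hU : IsUnitaryGroup U) {m : ℝ} (hm : 0 < m) (x y : H) :
    ⟪-laplaceVec (fun t => U (-t)) m x, y⟫_ℂ = ⟪x, laplaceVec U m y⟫_ℂ := by
  have h1 := hasGen_laplaceVec hU hm y
  have h2 := HasGen.neg_iff.mp (hasGen_laplaceVec hU.neg hm x)
  have h3 := h2.symm hU h1
  simp only [inner_neg_left, inner_sub_left, inner_sub_right, inner_smul_left, inner_smul_right,
    map_mul, Complex.conj_I, Complex.conj_ofReal] at h3 ⊢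
  linear_combination -h3

end Generators

/-! ### Weyl groups and resolvents in the defining representation -/

section Concrete

variable {X : Type*} [AddCommGroup X] [Module ℝ X] (σ : SymplecticForm X)

/-- The unitary group `t ↦ π_S(δ_{tf})`. -/
def weylGroup (f : X) (t : ℝ) : RegularSpace σ →L[ℂ] RegularSpace σ :=
  regularRep σ (weyl σ (t • f))

lemma form_self (f : X) : σ.form f f = 0 := σ.alt f

lemma weylGroup_neg (f : X) : weylGroup σ (-f) = fun t => weylGroup σ f (-t) := by
  funext t
  rw [weylGroup, weylGroup, smul_neg, neg_smul]

lemma isUnitaryGroup_weylGroup (f : X) : IsUnitaryGroup (weylGroup σ f) where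
  mem_unitary t := by
    have h2 : weyl σ (t • f) * weyl σ (-(t • f)) = 1 := by
      simpa using weyl_neg_mul σ (-(t • f))
    refine Unitary.mem_iff.mpr ⟨?_, ?_⟩
    · rw [weylGroup, ← map_star, ← map_mul, star_weyl, weyl_neg_mul, map_one]
    · rw [weylGroup, ← map_star, ← map_mul, star_weyl, h2, map_one]
  map_add s t := by
    rw [weylGroup, weylGroup, weylGroup, ← map_mul, weyl_mul, ← add_smul]
    simp [phase, form_self]
  continuous ψ := continuous_regularRep σ f ψ

lemma weylGroup_comm (f g : X) (s t : ℝ) (ψ : RegularSpace σ) :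
    weylGroup σ g t (weylGroup σ f s ψ) =
      Complex.exp (t * (Complex.I * ((s * σ.form f g : ℝ) : ℂ))) •
        weylGroup σ f s (weylGroup σ g t ψ) := by
  have h : weyl σ (t • g) * weyl σ (s • f) =
      Complex.exp (t * (Complex.I * ((s * σ.form f g : ℝ) : ℂ))) •
        (weyl σ (s • f) * weyl σ (t • g)) := by
    rw [weyl_mul, weyl_mul, smul_smul, add_comm]
    congr 1
    simp only [phase, ← Complex.exp_add]
    congr 1
    simp only [map_smul, LinearMap.smul_apply, smul_eq_mul, form_swap σ f g]
    push_cast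
    ring
  rw [weylGroup, weylGroup, ← mul_apply_eq_comp, ← map_mul, h, map_smul, map_mul]
  rfl

lemma weylGroup_add (f g : X) (l t : ℝ) (ψ : RegularSpace σ) :
    weylGroup σ (l • f + g) t ψ =
      Complex.exp ((t : ℂ) * t * (Complex.I * ((l * σ.form f g : ℝ) : ℂ) / 2)) •
        weylGroup σ f (t * l) (weylGroup σ g t ψ) := by
  have h : weyl σ (t • (l • f + g)) =
      Complex.exp ((t : ℂ) * t * (Complex.I * ((l * σ.form f g : ℝ) : ℂ) / 2)) •
        (weyl σ ((t * l) • f) * weyl σ (t • g)) := by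
    rw [weyl_mul, smul_smul, phase, ← Complex.exp_add, smul_add, smul_smul]
    have : (t : ℂ) * t * (Complex.I * ((l * σ.form f g : ℝ) : ℂ) / 2) +
        -(Complex.I * (σ.form ((t * l) • f) (t • g) : ℂ) / 2) = 0 := by
      simp only [map_smul, LinearMap.smul_apply, smul_eq_mul]
      push_cast
      ring
    rw [this, Complex.exp_zero, one_smul]
  rw [weylGroup, h, map_smul, map_mul]
  rfl

/-- The commutation phase of δ_{tg} and δ_{sf} is linear in `t` in the exponent; its derivative at
`0` is the shift of the generator. -/
lemma hasGen_weylGroup_apply {f g : X} {ψ φ : RegularSpace σ} (h : HasGen (weylGroup σ g) ψ φ)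
    (s : ℝ) : HasGen (weylGroup σ g) (weylGroup σ f s ψ)
      (weylGroup σ f s φ + ((s * σ.form f g : ℝ) : ℂ) • weylGroup σ f s ψ) := by
  set c : ℝ := s * σ.form f g
  have d1 : HasDerivAt (fun t : ℝ => Complex.exp (t * (Complex.I * (c : ℂ))))
      (Complex.I * c) 0 := by
    simpa using ((hasDerivAt_id (0 : ℝ)).ofReal_comp.mul_const (Complex.I * (c : ℂ))).cexp
  have d := d1.smul (hasDerivAt_clm_apply (weylGroup σ f s) h)
  refine (d.congr_of_eventuallyEq (Eventually.of_forall fun t =>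
    weylGroup_comm σ f g s t ψ)).congr_deriv ?_
  simp only [map_smul, (isUnitaryGroup_weylGroup σ g).map_zero_apply, Complex.ofReal_zero, zero_mul,
    Complex.exp_zero]
  module

/-- The phase in `weylGroup_add` is quadratic in `t`, so it does not contribute to the derivative at
`0`. -/
lemma hasGen_weylGroup_add {f g : X} {ψ φ φ' : RegularSpace σ} (h : HasGen (weylGroup σ f) ψ φ)
    (h' : HasGen (weylGroup σ g) ψ φ') (l : ℝ) :
    HasGen (weylGroup σ (l • f + g)) ψ ((l : ℂ) • φ + φ') := by
  have d1 : HasDerivAt (fun t : ℝ =>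
      Complex.exp ((t : ℂ) * t * (Complex.I * ((l * σ.form f g : ℝ) : ℂ) / 2))) 0 0 := by
    have := (((hasDerivAt_id (0 : ℝ)).ofReal_comp.mul (hasDerivAt_id (0 : ℝ)).ofReal_comp).mul_const
      (Complex.I * ((l * σ.form f g : ℝ) : ℂ) / 2)).cexp
    simpa using this
  have h0 : HasGen (weylGroup σ f) (weylGroup σ g 0 ψ) φ := by
    rwa [(isUnitaryGroup_weylGroup σ g).map_zero_apply]
  have d := d1.smul (HasGen.apply_curve (isUnitaryGroup_weylGroup σ f) h0 h' l)
  refine (d.congr_of_eventuallyEq (Eventually.of_forall fun t =>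
    weylGroup_add σ f g l t ψ)).congr_deriv ?_
  simp

lemma hasGen_weylGroup_smul {f : X} {ψ φ : RegularSpace σ} (h : HasGen (weylGroup σ f) ψ φ)
    (s : ℝ) : HasGen (weylGroup σ (s • f)) ψ ((s : ℂ) • φ) := by
  refine (h.comp_mul (isUnitaryGroup_weylGroup σ f) s).congr_of_eventuallyEq
    (Eventually.of_forall fun t => ?_)
  simp only [weylGroup, smul_smul]

lemma eq_zero_of_hasGen_weylGroup_zero {ψ φ : RegularSpace σ}
    (h : HasGen (weylGroup σ (0 : X)) ψ φ) : φ = 0 := by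
  have h1 : HasDerivAt (fun t => weylGroup σ (0 : X) t ψ) 0 0 := by
    simp only [weylGroup, smul_zero]
    exact hasDerivAt_const _ _
  simpa using HasDerivAt.unique h h1

lemma laplaceOp_apply {l : ℝ} (hl : 0 < l) (f : X) (ψ : RegularSpace σ) :
    laplaceOp σ l hl f ψ = laplaceVec (weylGroup σ f) l ψ := rfl

lemma star_laplaceOp {l : ℝ} (hl : 0 < l) (f : X) :
    star (laplaceOp σ l hl f) = -laplaceOp σ l hl (-f) := by
  rw [ContinuousLinearMap.star_eq_adjoint, eq_comm, ContinuousLinearMap.eq_adjoint_iff]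
  intro x y
  rw [_root_.neg_apply, laplaceOp_apply, laplaceOp_apply, weylGroup_neg]
  exact inner_laplaceVec (isUnitaryGroup_weylGroup σ f) hl x y

lemma resolventOp_of_pos {l : ℝ} (hl : 0 < l) (f : X) :
    resolventOp σ l f = laplaceOp σ l hl f := dif_pos hl

lemma resolventOp_of_neg {l : ℝ} (hl : 0 < -l) (f : X) :
    resolventOp σ l f = star (laplaceOp σ (-l) hl f) := by
  rw [resolventOp, dif_neg (by linarith), dif_pos hl]

lemma star_resolventOp {l : ℝ} (hl : l ≠ 0) (f : X) :
    star (resolventOp σ l f) = resolventOp σ (-l) f := by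
  rcases hl.lt_or_gt with h | h
  · rw [resolventOp_of_neg σ (neg_pos.mpr h), resolventOp_of_pos σ (neg_pos.mpr h), star_star]
  · have h' : 0 < -(-l) := by rwa [neg_neg]
    rw [resolventOp_of_neg σ h', resolventOp_of_pos σ h]
    simp only [neg_neg]

lemma norm_resolventOp_le {l : ℝ} (hl : l ≠ 0) (f : X) : ‖resolventOp σ l f‖ ≤ |l|⁻¹ := by
  have key : ∀ {m : ℝ} (hm : 0 < m), ‖laplaceOp σ m hm f‖ ≤ m⁻¹ := fun hm =>
    LinearMap.mkContinuous_norm_le _ (inv_nonneg.mpr hm.le) _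
  rcases hl.lt_or_gt with h | h
  · rw [resolventOp_of_neg σ (neg_pos.mpr h), norm_star, abs_of_neg h]
    exact key _
  · rw [resolventOp_of_pos σ h, abs_of_pos h]
    exact key _

/-- `π_S(R(λ,f))` is the resolvent `(iλ - φ(f))⁻¹` of the generator `φ(f)` of `π_S(δ_{tf})`. -/
lemma hasGen_weylGroup_iff {l : ℝ} (hl : l ≠ 0) (f : X) {ψ φ : RegularSpace σ} :
    HasGen (weylGroup σ f) ψ φ ↔ resolventOp σ l f ((Complex.I * (l : ℂ)) • ψ - φ) = ψ := by
  rcases hl.lt_or_gt with h | h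
  · have h1 := hasGen_iff_laplaceVec (isUnitaryGroup_weylGroup σ (-f)) (neg_pos.mpr h)
      (ψ := ψ) (φ := -φ)
    rw [← laplaceOp_apply, weylGroup_neg, HasGen.neg_iff, neg_neg] at h1
    rw [h1, resolventOp_of_neg σ (neg_pos.mpr h), star_laplaceOp, _root_.neg_apply, ← map_neg]
    have : (Complex.I * ((-l : ℝ) : ℂ)) • ψ - -φ = -((Complex.I * (l : ℂ)) • ψ - φ) := by
      push_cast; module
    rw [this]
  · rw [resolventOp_of_pos σ h, laplaceOp_apply]
    exact hasGen_iff_laplaceVec (isUnitaryGroup_weylGroup σ f) h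

lemma hasGen_resolventOp {l : ℝ} (hl : l ≠ 0) (f : X) (χ : RegularSpace σ) :
    HasGen (weylGroup σ f) (resolventOp σ l f χ)
      ((Complex.I * (l : ℂ)) • resolventOp σ l f χ - χ) := by
  rw [hasGen_weylGroup_iff σ hl, sub_sub_cancel]

/-- The shift of φ(g) by sσ(f,g), read through its resolvent. The correction carries the explicit
factor `s`, so it can be differentiated at `0` on every vector. -/
lemma weylGroup_resolventOp {m : ℝ} (hm : m ≠ 0) (f g : X) (s : ℝ) (χ : RegularSpace σ) :
    weylGroup σ f s (resolventOp σ m g χ) = resolventOp σ m g (weylGroup σ f s χ) -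
      s • ((σ.form f g : ℂ) • resolventOp σ m g (weylGroup σ f s (resolventOp σ m g χ))) := by
  have h := hasGen_weylGroup_apply σ (f := f) (hasGen_resolventOp σ hm g χ) s
  rw [hasGen_weylGroup_iff σ hm] at h
  nth_rewrite 1 [← h]
  rw [← Complex.coe_smul]
  simp only [map_sub, map_add, map_smul]
  push_cast
  module

/-- The commutator of the generator of `π_S(δ_{tf})` with a resolvent. -/
lemma hasGen_resolventOp_apply {m : ℝ} (hm : m ≠ 0) {f : X} (g : X) {ψ φ : RegularSpace σ}
    (h : HasGen (weylGroup σ f) ψ φ) :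
    HasGen (weylGroup σ f) (resolventOp σ m g ψ) (resolventOp σ m g φ +
      (Complex.I * (σ.form f g : ℂ)) • resolventOp σ m g (resolventOp σ m g ψ)) := by
  have hU := isUnitaryGroup_weylGroup σ f
  have d1 := hasDerivAt_clm_apply (resolventOp σ m g) h
  have d2 := hasDerivAt_smul_of_continuousAt (hU.continuous_smul_apply (resolventOp σ m g)
    (σ.form f g : ℂ) (resolventOp σ m g ψ)).continuousAt
  have d := d1.fun_sub d2
  simp only [← weylGroup_resolventOp σ hm f g] at d
  refine d.congr_deriv ?_
  rw [hU.map_zero_apply, map_smul]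
  linear_combination (norm := module) Complex.I_sq •
    (-(σ.form f g : ℂ) • resolventOp σ m g (resolventOp σ m g ψ))

/-! ### Algebraic identities in the resolvent algebra -/

variable {σ}

lemma R_coe {l : ℝ} {f : X} (hl : l ≠ 0) (hf : f ≠ 0) :
    (R σ l f : RegularSpace σ →L[ℂ] RegularSpace σ) = resolventOp σ l f := by
  rw [R, dif_pos ⟨hl, hf⟩]

lemma R_zero (f : X) : R σ 0 f = 0 := dif_neg (by simp)

lemma star_R (l : ℝ) {f : X} (hf : f ≠ 0) : star (R σ l f) = R σ (-l) f := by
  rcases eq_or_ne l 0 with rfl | hl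
  · rw [neg_zero, R_zero, star_zero]
  · refine Subtype.ext ?_
    rw [R_coe (neg_ne_zero.mpr hl) hf, ← star_resolventOp σ hl, ← R_coe hl hf]
    rfl

lemma norm_R_le (l : ℝ) {f : X} (hf : f ≠ 0) : ‖R σ l f‖ ≤ |l|⁻¹ := by
  rcases eq_or_ne l 0 with rfl | hl
  · simp [R_zero]
  · have := norm_resolventOp_le σ hl f
    rwa [← R_coe hl hf] at this

lemma R_sub {l m : ℝ} {f : X} (hl : l ≠ 0) (hm : m ≠ 0) (hf : f ≠ 0) :
    R σ l f - R σ m f = (Complex.I * ((m : ℂ) - l)) • (R σ l f * R σ m f) := by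
  refine Subtype.ext (ContinuousLinearMap.ext fun χ => ?_)
  change (R σ l f).1 χ - (R σ m f).1 χ =
    (Complex.I * ((m : ℂ) - l)) • (R σ l f).1 ((R σ m f).1 χ)
  rw [R_coe hl hf, R_coe hm hf]
  have h := (hasGen_weylGroup_iff σ hl f).mp (hasGen_resolventOp σ hm f χ)
  simp only [map_sub, map_smul] at h
  linear_combination (norm := module) h

lemma R_smul {s l : ℝ} {f : X} (hs : s ≠ 0) (hl : l ≠ 0) (hf : f ≠ 0) :
    (s : ℂ) • R σ (s * l) (s • f) = R σ l f := by
  refine Subtype.ext (ContinuousLinearMap.ext fun χ => ?_)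
  change (s : ℂ) • (R σ (s * l) (s • f)).1 χ = (R σ l f).1 χ
  rw [R_coe hl hf, R_coe (mul_ne_zero hs hl) (smul_ne_zero hs hf)]
  have h := (hasGen_weylGroup_iff σ (mul_ne_zero hs hl) (s • f)).mp
    (hasGen_weylGroup_smul σ (hasGen_resolventOp σ hl f χ) s)
  simp only [map_sub, map_smul] at h
  push_cast at h
  linear_combination (norm := module) h

/-- The relation [φ(f), R(m,g)] = iσ(f,g)R(m,g)² multiplied by R(l,f) on both sides. Only bounded
elements remain, so it holds in every representation. -/
lemma R_commutator {l m : ℝ} {f g : X} (hl : l ≠ 0) (hm : m ≠ 0) (hf : f ≠ 0) (hg : g ≠ 0) :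
    R σ l f * R σ m g = R σ m g * R σ l f +
      (Complex.I * (σ.form f g : ℂ)) • (R σ l f * (R σ m g * (R σ m g * R σ l f))) := by
  refine Subtype.ext (ContinuousLinearMap.ext fun χ => ?_)
  change (R σ l f).1 ((R σ m g).1 χ) = (R σ m g).1 ((R σ l f).1 χ) +
    (Complex.I * (σ.form f g : ℂ)) • (R σ l f).1 ((R σ m g).1 ((R σ m g).1 ((R σ l f).1 χ)))
  rw [R_coe hl hf, R_coe hm hg]
  have h := (hasGen_weylGroup_iff σ hl f).mp
    (hasGen_resolventOp_apply σ hm g (hasGen_resolventOp σ hl f χ))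
  simp only [map_sub, map_smul, map_add] at h
  linear_combination (norm := module) h

/-- The element `(l φ(f) + φ(h)) R(1,f) R(1,h)`. -/
def sumElem (σ : SymplecticForm X) (f h : X) (l : ℝ) : ResolventAlg σ :=
  (l : ℂ) • (Complex.I • (R σ 1 f * R σ 1 h) - R σ 1 h) +
    (Complex.I • (R σ 1 f * R σ 1 h) - R σ 1 f -
      (Complex.I * (σ.form f h : ℂ)) • (R σ 1 f * (R σ 1 f * R σ 1 h)))

lemma hasGen_sumElem {f h : X} (hf : f ≠ 0) (hh : h ≠ 0) (l : ℝ) (χ : RegularSpace σ) :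
    HasGen (weylGroup σ (l • f + h)) ((R σ 1 f).1 ((R σ 1 h).1 χ)) ((sumElem σ f h l).1 χ) := by
  have e : (sumElem σ f h l).1 χ =
      (l : ℂ) • (Complex.I • (R σ 1 f).1 ((R σ 1 h).1 χ) - (R σ 1 h).1 χ) +
      (Complex.I • (R σ 1 f).1 ((R σ 1 h).1 χ) - (R σ 1 f).1 χ -
      (Complex.I * (σ.form f h : ℂ)) • (R σ 1 f).1 ((R σ 1 f).1 ((R σ 1 h).1 χ))) := rfl
  rw [e, R_coe one_ne_zero hf, R_coe one_ne_zero hh]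
  have h1 := hasGen_resolventOp σ one_ne_zero f (resolventOp σ 1 h χ)
  have h2 := hasGen_resolventOp_apply σ one_ne_zero f (hasGen_resolventOp σ one_ne_zero h χ)
  rw [Complex.ofReal_one, mul_one] at h1 h2
  have h3 := hasGen_weylGroup_add σ h1 h2 l
  rw [form_swap σ f h, map_sub, map_smul] at h3
  refine h3.congr_deriv (congrArg _ ?_)
  push_cast
  module

/-- Additivity of the fields as an equation in the algebra. It also places the joint domain inside
the range of π(R(1,lf+h)). -/
lemma R_sum {f h : X} (hf : f ≠ 0) (hh : h ≠ 0) (l : ℝ) (hk : l • f + h ≠ 0) :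
    R σ 1 (l • f + h) * (Complex.I • (R σ 1 f * R σ 1 h) - sumElem σ f h l) =
      R σ 1 f * R σ 1 h := by
  refine Subtype.ext (ContinuousLinearMap.ext fun χ => ?_)
  change (R σ 1 (l • f + h)).1 (Complex.I • (R σ 1 f).1 ((R σ 1 h).1 χ) -
    (sumElem σ f h l).1 χ) = (R σ 1 f).1 ((R σ 1 h).1 χ)
  have h1 := (hasGen_weylGroup_iff σ one_ne_zero (l • f + h)).mp (hasGen_sumElem hf hh l χ)
  rwa [Complex.ofReal_one, mul_one, ← R_coe one_ne_zero hk] at h1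

/-- Here the Weyl group of `l • f + h` is constant with generator `0`, in accordance with the
convention `field π 0 = 0`. -/
lemma sumElem_eq_zero {f h : X} (hf : f ≠ 0) (hh : h ≠ 0) (l : ℝ) (hk : l • f + h = 0) :
    sumElem σ f h l = 0 := by
  refine Subtype.ext (ContinuousLinearMap.ext fun χ => ?_)
  have h1 := hasGen_sumElem (σ := σ) hf hh l χ
  rw [hk] at h1
  exact eq_zero_of_hasGen_weylGroup_zero σ h1

end Concrete

/-! ### Resolvents at complex points -/

section ComplexResolvent

variable {X : Type*} [AddCommGroup X] [Module ℝ X] {σ : SymplecticForm X}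

lemma neumannTerm_eq (μ : ℝ) (z : ℂ) (f : X) (n : ℕ) :
    neumannTerm σ μ z f n = ((Complex.I * ((μ : ℂ) - z)) • R σ μ f) ^ n * R σ μ f := by
  rw [neumannTerm, pow_succ, smul_pow, mul_pow, mul_comm (Complex.I ^ n), smul_mul_assoc]

lemma norm_neumann_lt_one {μ : ℝ} {z : ℂ} {f : X} (hf : f ≠ 0) (hμ : ‖z - μ‖ < |μ|) :
    ‖(Complex.I * ((μ : ℂ) - z)) • R σ μ f‖ < 1 := by
  have h0 : 0 < |μ| := (norm_nonneg _).trans_lt hμ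
  rw [norm_smul, norm_mul, Complex.norm_I, one_mul, norm_sub_rev]
  calc ‖z - μ‖ * ‖R σ μ f‖ ≤ ‖z - μ‖ * |μ|⁻¹ := by gcongr; exact norm_R_le μ hf
    _ < 1 := by rwa [← div_eq_mul_inv, div_lt_one h0]

lemma hasSum_neumannTerm {μ : ℝ} {z : ℂ} {f : X} (hf : f ≠ 0) (hμ : ‖z - μ‖ < |μ|) :
    HasSum (neumannTerm σ μ z f)
      ((∑' n : ℕ, ((Complex.I * ((μ : ℂ) - z)) • R σ μ f) ^ n) * R σ μ f) := by
  simp only [funext (neumannTerm_eq μ z f)]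
  exact (summable_geometric_of_norm_lt_one (norm_neumann_lt_one hf hμ)).hasSum.mul_right _

/-- With `m = |z|²/Re z` one has `|z - m|² = m² - |z|²`. -/
lemma norm_sub_center_lt {z : ℂ} (hz : z.re ≠ 0) :
    ‖z - ((‖z‖ ^ 2 / z.re : ℝ) : ℂ)‖ < |‖z‖ ^ 2 / z.re| := by
  set m : ℝ := ‖z‖ ^ 2 / z.re with hm
  have h1 : m * z.re = ‖z‖ ^ 2 := div_mul_cancel₀ _ hz
  have h2 : 0 < ‖z‖ ^ 2 := by
    have : z ≠ 0 := fun h => hz (by simp [h])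
    positivity
  refine lt_of_pow_lt_pow_left₀ 2 (abs_nonneg _) ?_
  rw [sq_abs, ← Complex.normSq_eq_norm_sq, Complex.normSq_apply]
  rw [← Complex.normSq_eq_norm_sq, Complex.normSq_apply] at h1 h2
  simp only [Complex.sub_re, Complex.ofReal_re, Complex.sub_im, Complex.ofReal_im, sub_zero]
  nlinarith

/-- An element satisfying the resolvent equation at one centre satisfies it at every centre. -/
lemma resolvent_equation_of_center {μ ν : ℝ} (hμ : μ ≠ 0) (hν : ν ≠ 0) {z : ℂ} {f : X}
    (hf : f ≠ 0) {N : ResolventAlg σ}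
    (hN : N = R σ ν f + (Complex.I * ((ν : ℂ) - z)) • (R σ ν f * N)) :
    N = R σ μ f + (Complex.I * ((μ : ℂ) - z)) • (R σ μ f * N) := by
  have h1 := R_sub (σ := σ) hμ hν hf
  have h2 : R σ μ f * N - R σ ν f * N =
      (Complex.I * ((ν : ℂ) - μ)) • (R σ μ f * (R σ ν f * N)) := by
    rw [← sub_mul, h1, smul_mul_assoc, mul_assoc]
  have h3 : R σ μ f * N = R σ μ f * R σ ν f +
      (Complex.I * ((ν : ℂ) - z)) • (R σ μ f * (R σ ν f * N)) := by
    conv_lhs => rw [hN, mul_add, mul_smul_comm]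
  linear_combination (norm := module) hN - h1 + (Complex.I * ((ν : ℂ) - μ)) • h3 -
    ((Complex.I * ((ν : ℂ) - z))) • h2

lemma neumann_equation {μ : ℝ} {z : ℂ} {f : X} (hf : f ≠ 0) (hμ : ‖z - μ‖ < |μ|) :
    (∑' n : ℕ, ((Complex.I * ((μ : ℂ) - z)) • R σ μ f) ^ n) * R σ μ f = R σ μ f +
      (Complex.I * ((μ : ℂ) - z)) • (R σ μ f *
        ((∑' n : ℕ, ((Complex.I * ((μ : ℂ) - z)) • R σ μ f) ^ n) * R σ μ f)) := by
  have h := mul_neg_geom_series _ (norm_neumann_lt_one (σ := σ) hf hμ)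
  set x := (Complex.I * ((μ : ℂ) - z)) • R σ μ f with hx
  rw [← smul_mul_assoc, ← hx, ← mul_assoc, ← sub_eq_iff_eq_add, ← sub_mul, ← one_sub_mul, h,
    one_mul]

/-- The equation holds even at centres not covered by the convergence condition. It is used at `μ =
l` with `z = l + iσ(h,f)`, where `|z - l| < |l|` may fail. -/
lemma complexR_equation {z : ℂ} (hz : z.re ≠ 0) {f : X} (hf : f ≠ 0) {μ : ℝ} (hμ : μ ≠ 0) :
    complexR σ z f = R σ μ f + (Complex.I * ((μ : ℂ) - z)) • (R σ μ f * complexR σ z f) := by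
  have h0 := norm_sub_center_lt hz
  have h1 : ‖z‖ ^ 2 / z.re ≠ 0 := abs_pos.mp ((norm_nonneg _).trans_lt h0)
  rw [complexR, (hasSum_neumannTerm hf h0).tsum_eq]
  exact resolvent_equation_of_center hμ h1 hf (neumann_equation hf h0)

/-- At an admissible centre `1 - i(μ - z)R(μ,f)` is invertible, so the resolvent equation has a
single solution, the sum of the series. -/
lemma hasSum_complexR {z : ℂ} (hz : z.re ≠ 0) {f : X} (hf : f ≠ 0) {μ : ℝ}
    (hμ : ‖z - μ‖ < |μ|) : HasSum (neumannTerm σ μ z f) (complexR σ z f) := by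
  have h0 : μ ≠ 0 := abs_pos.mp ((norm_nonneg _).trans_lt hμ)
  have h1 := hasSum_neumannTerm (σ := σ) hf hμ
  have h2 := geom_series_mul_neg _ (norm_neumann_lt_one (σ := σ) hf hμ)
  have h3 := complexR_equation (σ := σ) hz hf h0
  set x := (Complex.I * ((μ : ℂ) - z)) • R σ μ f with hx
  rw [← smul_mul_assoc, ← hx, ← sub_eq_iff_eq_add, ← one_sub_mul] at h3
  have h4 : complexR σ z f = (∑' n : ℕ, x ^ n) * R σ μ f := by
    rw [← h3, ← mul_assoc, h2, one_mul]
  rw [h4]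
  exact h1

end ComplexResolvent

/-! ### Field operators in a representation -/

section Representation

variable {X : Type*} [AddCommGroup X] [Module ℝ X] {σ : SymplecticForm X}
  {H : Type*} [NormedAddCommGroup H] [InnerProductSpace ℂ H] [CompleteSpace H]

omit [CompleteSpace H] in
lemma exists_apply_eq_of_mem_graph {A : H →ₗ.[ℂ] H} {ψ φ : H} (h : (ψ, φ) ∈ A.graph) :
    ∃ d : ψ ∈ A.domain, A ⟨ψ, d⟩ = φ := by
  obtain ⟨y, rfl, hy⟩ := A.mem_graph_iff.mp h
  exact ⟨y.2, hy⟩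

variable (π : ResolventAlg σ →⋆ₙₐ[ℂ] (H →L[ℂ] H)) {f g h : X}

/-- Trades the inverse and its domain for one equation in a bounded operator. -/
lemma field_mem_graph (hf : f ≠ 0) (ker : LinearMap.ker (π (R σ 1 f) : H →ₗ[ℂ] H) = ⊥)
    (ψ φ : H) : (ψ, φ) ∈ (field π f).graph ↔ π (R σ 1 f) (Complex.I • ψ - φ) = ψ := by
  set T := ((π (R σ 1 f) : H →ₗ[ℂ] H).toPMap ⊤) with hT
  have hkerT : LinearMap.ker T.toFun = ⊥ := by
    rw [LinearMap.ker_eq_bot'] at ker ⊢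
    exact fun m hm => Subtype.ext (ker m hm)
  have hfield : field π f = (Complex.I • LinearMap.id : H →ₗ[ℂ] H).toPMap ⊤ - T.inverse := if_neg hf
  rw [hfield, LinearPMap.mem_graph_iff]
  constructor
  · rintro ⟨⟨y, hy1, hy2⟩, rfl, hy⟩
    have hy3 := hy2
    rw [LinearPMap.inverse_domain] at hy3
    obtain ⟨χ, hχ⟩ := hy3
    have h1 : T.inverse ⟨y, hy2⟩ = χ := LinearPMap.inverse_apply_eq hkerT hχ
    rw [LinearPMap.sub_apply] at hy
    change Complex.I • y - T.inverse ⟨y, hy2⟩ = φ at hy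
    rw [h1] at hy
    change π (R σ 1 f) (Complex.I • y - φ) = y
    rw [← hy, sub_sub_cancel]
    exact hχ
  · intro hψ
    have hy2 : ψ ∈ T.inverse.domain := by
      rw [LinearPMap.inverse_domain]
      exact ⟨⟨Complex.I • ψ - φ, trivial⟩, hψ⟩
    have h1 : T.inverse ⟨ψ, hy2⟩ = Complex.I • ψ - φ :=
      LinearPMap.inverse_apply_eq hkerT (x := ⟨Complex.I • ψ - φ, trivial⟩) hψ
    refine ⟨⟨ψ, trivial, hy2⟩, rfl, ?_⟩
    rw [LinearPMap.sub_apply]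
    change Complex.I • ψ - T.inverse ⟨ψ, hy2⟩ = φ
    rw [h1, sub_sub_cancel]

/-- Injectivity enters only in the graph axiom; the others are images of relations in the algebra.
At `l = 0` they hold because `R σ 0 f = 0`. -/
lemma isResolventFamily_field (hf : f ≠ 0)
    (ker : LinearMap.ker (π (R σ 1 f) : H →ₗ[ℂ] H) = ⊥) :
    IsResolventFamily (field π f) fun l => π (R σ l f) where
  star_eq l := by rw [← map_star, star_R l hf]
  norm_le l := (NonUnitalStarAlgHom.norm_apply_le π _).trans (norm_R_le l hf)
  sub_eq l m hl hm := by rw [← map_sub, R_sub hl hm hf, map_smul, map_mul]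
  mem_graph_one := field_mem_graph π hf ker

lemma rep_commutator {l m : ℝ} (hl : l ≠ 0) (hm : m ≠ 0) (hf : f ≠ 0) (hg : g ≠ 0) (χ : H) :
    π (R σ l f) (π (R σ m g) χ) = π (R σ m g) (π (R σ l f) χ) + (Complex.I * (σ.form f g : ℂ)) •
      π (R σ l f) (π (R σ m g) (π (R σ m g) (π (R σ l f) χ))) := by
  have h1 := congrArg (fun a => π a χ) (R_commutator (σ := σ) hl hm hf hg)
  simp only [map_add, map_smul, map_mul] at h1
  exact h1

lemma rep_smul {s l : ℝ} (hs : s ≠ 0) (hl : l ≠ 0) (hf : f ≠ 0) :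
    π (R σ l (s • f)) = (s : ℂ)⁻¹ • π (R σ (s⁻¹ * l) f) := by
  rw [← R_smul hs (mul_ne_zero (inv_ne_zero hs) hl) hf, map_smul, smul_smul,
    inv_mul_cancel₀ (by exact_mod_cast hs), one_smul, mul_inv_cancel_left₀ hs]

/-- Applied to `iψ - φ`, the rightmost factor π(R(1,f)) of `rep_commutator` returns `ψ`; this
recovers the commutator on the whole domain of `field π f`. -/
lemma mem_graph_commutator (hf : f ≠ 0) (kerf : LinearMap.ker (π (R σ 1 f) : H →ₗ[ℂ] H) = ⊥)
    (hg : g ≠ 0) {l : ℝ} (hl : l ≠ 0) {ψ φ : H} (hψ : (ψ, φ) ∈ (field π f).graph) :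
    (π (R σ l g) ψ, π (R σ l g) φ + (Complex.I * (σ.form f g : ℂ)) •
      π (R σ l g) (π (R σ l g) ψ)) ∈ (field π f).graph := by
  rw [field_mem_graph π hf kerf] at hψ ⊢
  have h1 := rep_commutator π one_ne_zero hl hf hg (Complex.I • ψ - φ)
  rw [hψ] at h1
  simp only [map_sub, map_smul, map_add] at h1 ⊢
  linear_combination (norm := module) h1

lemma mem_jointDomain_iff {ψ : H} :
    ψ ∈ jointDomain π f h ↔ ∃ χ, π (R σ 1 f) (π (R σ 1 h) χ) = ψ := by
  rw [jointDomain, LinearMap.mem_range, map_mul]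
  rfl

/-- In the commutator identity the correction term also begins with π(R(1,h)R(1,f)), so it is
absorbed into the argument. -/
lemma jointDomain_le_swap (hf : f ≠ 0) (hh : h ≠ 0) : jointDomain π f h ≤ jointDomain π h f := by
  intro ψ hψ
  obtain ⟨χ, rfl⟩ := (mem_jointDomain_iff π).mp hψ
  have h1 := rep_commutator π one_ne_zero one_ne_zero hh hf χ
  refine (mem_jointDomain_iff π).mpr
    ⟨χ - (Complex.I * (σ.form h f : ℂ)) • π (R σ 1 f) (π (R σ 1 h) χ), ?_⟩
  simp only [map_sub, map_smul]
  linear_combination (norm := module) h1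

lemma jointDomain_comm (hf : f ≠ 0) (hh : h ≠ 0) : jointDomain π f h = jointDomain π h f :=
  le_antisymm (jointDomain_le_swap π hf hh) (jointDomain_le_swap π hh hf)

lemma mem_graph_left (hf : f ≠ 0)
    (kerf : LinearMap.ker (π (R σ 1 f) : H →ₗ[ℂ] H) = ⊥) (χ : H) : (π (R σ 1 f) (π (R σ 1 h) χ),
    Complex.I • π (R σ 1 f) (π (R σ 1 h) χ) - π (R σ 1 h) χ) ∈ (field π f).graph :=
  (isResolventFamily_field π hf kerf).one_apply_mem_graph _

lemma mem_graph_right (hf : f ≠ 0) (hh : h ≠ 0)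
    (kerh : LinearMap.ker (π (R σ 1 h) : H →ₗ[ℂ] H) = ⊥) (χ : H) : (π (R σ 1 f) (π (R σ 1 h) χ),
    Complex.I • π (R σ 1 f) (π (R σ 1 h) χ) - π (R σ 1 f) χ - (Complex.I * (σ.form f h : ℂ)) •
      π (R σ 1 f) (π (R σ 1 f) (π (R σ 1 h) χ))) ∈ (field π h).graph := by
  have h1 := mem_graph_commutator π hh kerh hf one_ne_zero
    ((isResolventFamily_field π hh kerh).one_apply_mem_graph χ)
  rw [form_swap σ f h, map_sub, map_smul] at h1
  convert h1 using 2
  push_cast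
  module

lemma rep_sumElem_apply (l : ℝ) (χ : H) : π (sumElem σ f h l) χ =
    (l : ℂ) • (Complex.I • π (R σ 1 f) (π (R σ 1 h) χ) - π (R σ 1 h) χ) +
      (Complex.I • π (R σ 1 f) (π (R σ 1 h) χ) - π (R σ 1 f) χ -
        (Complex.I * (σ.form f h : ℂ)) • π (R σ 1 f) (π (R σ 1 f) (π (R σ 1 h) χ))) := by
  simp only [sumElem, map_add, map_sub, map_smul, map_mul]
  rfl

lemma rep_sum (hf : f ≠ 0) (hh : h ≠ 0) (l : ℝ) (hk : l • f + h ≠ 0) (χ : H) :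
    π (R σ 1 (l • f + h)) (Complex.I • π (R σ 1 f) (π (R σ 1 h) χ) - π (sumElem σ f h l) χ) =
      π (R σ 1 f) (π (R σ 1 h) χ) := by
  have h1 := congrArg (fun a => π a χ) (R_sum (σ := σ) hf hh l hk)
  simp only [map_sub, map_smul, map_mul] at h1
  exact h1

/-! ### Commutation relations, sums and the common core -/

section Pair

variable (hf : f ≠ 0) (hh : h ≠ 0) (kerf : LinearMap.ker (π (R σ 1 f) : H →ₗ[ℂ] H) = ⊥)
  (kerh : LinearMap.ker (π (R σ 1 h) : H →ₗ[ℂ] H) = ⊥)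
include hf hh kerf kerh

lemma dense_jointDomain : Dense (jointDomain π f h : Set H) := by
  have h1 := (isResolventFamily_field π hf kerf).denseRange one_ne_zero
  have h2 := (isResolventFamily_field π hh kerh).denseRange one_ne_zero
  have h3 := h1.comp h2 (π (R σ 1 f)).continuous
  refine Dense.mono ?_ h3
  rintro _ ⟨χ, rfl⟩
  exact (mem_jointDomain_iff π).mpr ⟨χ, rfl⟩

lemma commutator_field (ψ : H) (hψ : ψ ∈ jointDomain π f h) :
    ∃ (df : ψ ∈ (field π f).domain) (dh : ψ ∈ (field π h).domain)
      (dfh : field π h ⟨ψ, dh⟩ ∈ (field π f).domain)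
      (dhf : field π f ⟨ψ, df⟩ ∈ (field π h).domain),
      field π f ⟨field π h ⟨ψ, dh⟩, dfh⟩ - field π h ⟨field π f ⟨ψ, df⟩, dhf⟩ =
        (Complex.I * (σ.form f h : ℂ)) • ψ := by
  obtain ⟨χ, rfl⟩ := (mem_jointDomain_iff π).mp hψ
  have rf := isResolventFamily_field π hf kerf
  have rh := isResolventFamily_field π hh kerh
  have g1 := mem_graph_left (h := h) π hf kerf χ
  have g2 := mem_graph_right π hf hh kerh χ
  -- The image of `ψ` under either field is a combination of vectors already located in the domain
  -- of the other, so the second application is linear algebra in the graph.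
  have g3 := (field π h).graph.sub_mem ((field π h).graph.smul_mem Complex.I g2)
    (rh.one_apply_mem_graph χ)
  have g4 := (field π f).graph.sub_mem ((field π f).graph.sub_mem
    ((field π f).graph.smul_mem Complex.I g1) (rf.one_apply_mem_graph χ))
    ((field π f).graph.smul_mem (Complex.I * (σ.form f h : ℂ))
      (rf.one_apply_mem_graph (π (R σ 1 f) (π (R σ 1 h) χ))))
  simp only [Prod.smul_mk, Prod.mk_sub_mk] at g3 g4
  obtain ⟨df, ef⟩ := exists_apply_eq_of_mem_graph g1
  obtain ⟨dh, eh⟩ := exists_apply_eq_of_mem_graph g2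
  rw [← ef] at g3
  rw [← eh] at g4
  obtain ⟨dhf, ehf⟩ := exists_apply_eq_of_mem_graph g3
  obtain ⟨dfh, efh⟩ := exists_apply_eq_of_mem_graph g4
  refine ⟨df, dh, dfh, dhf, ?_⟩
  rw [efh, ehf]
  module

/-- `T` is normal by the resolvent identity, so its kernel is that of `T⋆`, the orthogonal
complement of its range. By `R_sum` the range contains the dense joint domain. -/
lemma ker_sum (l : ℝ) (hk : l • f + h ≠ 0) :
    LinearMap.ker (π (R σ 1 (l • f + h)) : H →ₗ[ℂ] H) = ⊥ := by
  set T := π (R σ 1 (l • f + h)) with hT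
  have hnormal : star T * T = T * star T := by
    have h1 : (2 * Complex.I) • (star T * T) = (2 * Complex.I) • (T * star T) := by
      have e1 := R_sub (σ := σ) (l := 1) (m := -1) one_ne_zero (by norm_num) hk
      have e2 := R_sub (σ := σ) (l := -1) (m := 1) (by norm_num) one_ne_zero hk
      rw [hT, ← map_star, star_R 1 hk, ← map_mul, ← map_mul, ← map_smul, ← map_smul]
      congr 1
      push_cast at e1 e2
      linear_combination (norm := module) -e1 - e2
    exact smul_right_injective _ (by simp : (2 * Complex.I) ≠ 0) h1
  rw [LinearMap.ker_eq_bot']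
  intro ψ hψ
  have hψ' : T ψ = 0 := hψ
  have hstar : star T ψ = 0 := by
    have h1 : T (star T ψ) = 0 := by
      rw [← mul_apply_eq_comp, ← hnormal, mul_apply_eq_comp, hψ', map_zero]
    rw [← inner_self_eq_zero (𝕜 := ℂ), ContinuousLinearMap.star_eq_adjoint,
      ContinuousLinearMap.adjoint_inner_left, ← ContinuousLinearMap.star_eq_adjoint, h1,
      inner_zero_right]
  refine (dense_jointDomain π hf hh kerf kerh).eq_zero_of_inner_left ℂ fun v hv => ?_
  obtain ⟨χ, rfl⟩ := (mem_jointDomain_iff π).mp hv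
  rw [← rep_sum π hf hh l hk, ← hT, ← ContinuousLinearMap.adjoint_inner_left,
    ← ContinuousLinearMap.star_eq_adjoint, hstar, inner_zero_left]

lemma mem_graph_sum (l : ℝ) (χ : H) : (π (R σ 1 f) (π (R σ 1 h) χ),
    (l : ℂ) • (Complex.I • π (R σ 1 f) (π (R σ 1 h) χ) - π (R σ 1 h) χ) +
      (Complex.I • π (R σ 1 f) (π (R σ 1 h) χ) - π (R σ 1 f) χ -
        (Complex.I * (σ.form f h : ℂ)) • π (R σ 1 f) (π (R σ 1 f) (π (R σ 1 h) χ)))) ∈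
    (field π (l • f + h)).graph := by
  rw [← rep_sumElem_apply π]
  by_cases hk : l • f + h = 0
  · rw [sumElem_eq_zero hf hh l hk, hk, map_zero, _root_.zero_apply, field, if_pos rfl,
      LinearPMap.mem_graph_iff]
    exact ⟨⟨_, trivial⟩, rfl, rfl⟩
  · rw [field_mem_graph π hk (ker_sum π hf hh kerf kerh l hk)]
    exact rep_sum π hf hh l hk χ

lemma field_sum (l : ℝ) (ψ : H) (hψ : ψ ∈ jointDomain π f h) :
    ∃ (d : ψ ∈ (field π (l • f + h)).domain) (df : ψ ∈ (field π f).domain)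
      (dh : ψ ∈ (field π h).domain),
      field π (l • f + h) ⟨ψ, d⟩ = (l : ℂ) • field π f ⟨ψ, df⟩ + field π h ⟨ψ, dh⟩ := by
  obtain ⟨χ, rfl⟩ := (mem_jointDomain_iff π).mp hψ
  obtain ⟨df, ef⟩ := exists_apply_eq_of_mem_graph (mem_graph_left (h := h) π hf kerf χ)
  obtain ⟨dh, eh⟩ := exists_apply_eq_of_mem_graph (mem_graph_right π hf hh kerh χ)
  obtain ⟨d, e⟩ := exists_apply_eq_of_mem_graph (mem_graph_sum π hf hh kerf kerh l χ)
  exact ⟨d, df, dh, by rw [e, ef, eh]⟩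

/-- The graph is parametrized continuously by `χ ↦ (Rχ, iRχ - χ)` with `R = π(R(1,f))`; the joint
domain corresponds to `χ` in the dense range of π(R(1,h)). -/
lemma hasCore_jointDomain : (field π f).HasCore (jointDomain π f h) := by
  have rf := isResolventFamily_field π hf kerf
  have hle : jointDomain π f h ≤ (field π f).domain := fun ψ hψ =>
    (commutator_field π hf hh kerf kerh ψ hψ).1
  have hclosed : (field π f).IsClosed := rf.isSelfAdjoint.isClosed
  have hclosable : ((field π f).domRestrict (jointDomain π f h)).IsClosable :=
    hclosed.isClosable.leIsClosable LinearPMap.domRestrict_le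
  refine ⟨hle, LinearPMap.eq_of_eq_graph ?_⟩
  rw [← hclosable.graph_closure_eq_closure_graph]
  refine le_antisymm (Submodule.topologicalClosure_minimal _
    (LinearPMap.le_graph_of_le LinearPMap.domRestrict_le) hclosed) ?_
  rintro ⟨ψ, φ⟩ hψ
  rw [rf.mem_graph_one] at hψ
  set χ := Complex.I • ψ - φ with hχ
  have hφ : φ = Complex.I • π (R σ 1 f) χ - χ := by rw [hψ, hχ]; abel
  rw [← hψ, hφ]
  have hcont : Continuous fun χ => (π (R σ 1 f) χ, Complex.I • π (R σ 1 f) χ - χ) := by fun_prop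
  have hdense := (isResolventFamily_field π hh kerh).denseRange one_ne_zero
  refine map_mem_closure (f := fun χ => (π (R σ 1 f) χ, Complex.I • π (R σ 1 f) χ - χ)) hcont
    (hdense χ) ?_
  rintro _ ⟨η, rfl⟩
  have g1 := mem_graph_left (h := h) π hf kerf η
  obtain ⟨d, e⟩ := exists_apply_eq_of_mem_graph g1
  refine (LinearPMap.mem_graph_iff _).mpr
    ⟨⟨_, (mem_jointDomain_iff π).mpr ⟨η, rfl⟩, d⟩, rfl, ?_⟩
  exact (LinearPMap.domRestrict_apply (y := ⟨_, d⟩) rfl).trans e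

end Pair

/-! ### Weyl unitaries in a representation -/

section Unitary

variable (hf : f ≠ 0) (kerf : LinearMap.ker (π (R σ 1 f) : H →ₗ[ℂ] H) = ⊥)
include hf kerf

lemma expI_mem_unitary : expI (field π f) ∈ unitary (H →L[ℂ] H) := by
  obtain ⟨U, hU, e⟩ := expI_spec (isResolventFamily_field π hf kerf).exists_isUnitaryGroupOf
  rw [e]
  exact hU.mem_unitary 1

lemma expI_apply_resolvent (hg : g ≠ 0) {l : ℝ} (hl : l ≠ 0) (χ : H) :
    expI (field π f) (π (R σ l g) χ) = π (R σ l g) (expI (field π f) χ) -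
      (σ.form f g : ℂ) • π (R σ l g) (expI (field π f) (π (R σ l g) χ)) := by
  have rf := isResolventFamily_field π hf kerf
  obtain ⟨U, hU, e⟩ := expI_spec rf.exists_isUnitaryGroupOf
  rw [e]
  refine hU.isUnitaryGroup.intertwine (rf.dense_hasGen hU) (π (R σ l g)) (σ.form f g) ?_ χ
  intro ψ φ hψ
  exact (hU.generator _ _).mp
    (mem_graph_commutator π hf kerf hg hl ((hU.generator _ _).mpr hψ))

lemma expI_apply_self {l : ℝ} (hl : l ≠ 0) (χ : H) :
    expI (field π f) (π (R σ l f) χ) = π (R σ l f) (expI (field π f) χ) := by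
  have h1 := expI_apply_resolvent π hf kerf hf hl χ
  rwa [form_self, Complex.ofReal_zero, zero_smul, sub_zero] at h1

lemma expI_mem_jointDomain (hh : h ≠ 0) {ψ : H} (hψ : ψ ∈ jointDomain π f h) :
    expI (field π f) ψ ∈ jointDomain π f h := by
  obtain ⟨χ, rfl⟩ := (mem_jointDomain_iff π).mp hψ
  refine (mem_jointDomain_iff π).mpr ⟨expI (field π f) χ - (σ.form f h : ℂ) •
    expI (field π f) (π (R σ 1 h) χ), ?_⟩
  rw [expI_apply_self π hf kerf one_ne_zero, map_sub (π (R σ 1 h)), map_smul]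
  exact congrArg _ (expI_apply_resolvent π hf kerf hh one_ne_zero χ).symm

/-- Applied to `iψ - φ`, the intertwining relation says that W(f) shifts `field π h` by σ(f,h);
`IsUnitaryGroup.weyl_relation` converts the shift into a phase. -/
lemma weyl_relation_field (hh : h ≠ 0) (kerh : LinearMap.ker (π (R σ 1 h) : H →ₗ[ℂ] H) = ⊥) :
    expI (field π f) * expI (field π h) = Complex.exp (-(Complex.I * (σ.form f h : ℂ))) •
      (expI (field π h) * expI (field π f)) := by
  have rh := isResolventFamily_field π hh kerh
  obtain ⟨V, hV, e⟩ := expI_spec rh.exists_isUnitaryGroupOf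
  have h1 := hV.isUnitaryGroup.weyl_relation (rh.dense_hasGen hV) (expI_mem_unitary π hf kerf)
    (σ.form f h) (fun ψ φ hψ => ?_) 1
  · rw [e, h1, smul_smul, ← Complex.exp_add]
    simp
  · refine (hV.generator _ _).mp ?_
    have hψ' := (hV.generator _ _).mpr hψ
    rw [rh.mem_graph_one] at hψ' ⊢
    have h2 := expI_apply_resolvent π hf kerf hh one_ne_zero (Complex.I • ψ - φ)
    rw [hψ'] at h2
    simp only [map_sub, map_smul, map_add] at h2 ⊢
    linear_combination (norm := module) -h2

/-- On each vector `χ` both sides solve `Y = Rχ - σ(f,h)RY` with `R = π(R(l,h))`. Their difference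
satisfies the eigenvalue equation of the symmetric operator `field π h` at the nonreal value `il +
σ(f,h)`, hence is zero. This works without any smallness of σ(f,h). -/
lemma expI_conj_resolvent (hh : h ≠ 0) (kerh : LinearMap.ker (π (R σ 1 h) : H →ₗ[ℂ] H) = ⊥)
    {l : ℝ} (hl : l ≠ 0) : expI (field π f) * π (R σ l h) * star (expI (field π f)) =
      π (complexR σ ((l : ℂ) + Complex.I * (σ.form h f : ℂ)) h) := by
  have rh := isResolventFamily_field π hh kerh
  set W := expI (field π f) with hW
  have hWs : ∀ ψ, W (star W ψ) = ψ := fun ψ => congrArg (fun T : H →L[ℂ] H => T ψ)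
    (Unitary.mem_iff.mp (expI_mem_unitary π hf kerf)).2
  have hz : ((l : ℂ) + Complex.I * (σ.form h f : ℂ)).re ≠ 0 := by simpa using hl
  refine ContinuousLinearMap.ext fun χ => ?_
  have h1 := expI_apply_resolvent π hf kerf hh hl (star W χ)
  rw [← hW, hWs] at h1
  have h2 := congrArg (fun a => π a χ) (complexR_equation (σ := σ) hz hh hl)
  simp only [map_add, map_smul, map_mul] at h2
  rw [_root_.add_apply, _root_.smul_apply, mul_apply_eq_comp, form_swap σ f h] at h2
  rw [mul_apply_eq_comp, mul_apply_eq_comp, form_swap σ f h]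
  set C := π (complexR σ ((l : ℂ) + Complex.I * ((-σ.form f h : ℝ) : ℂ)) h) χ
  set Y := W (π (R σ l h) (star W χ))
  have h3 : π (R σ l h) (-(σ.form f h : ℂ) • (Y - C)) = Y - C := by
    push_cast at h2
    rw [map_smul, map_sub]
    linear_combination (norm := module) h2 - h1 + Complex.I_sq • ((σ.form f h : ℂ) • π (R σ l h) C)
  have h4 : (Y - C, (Complex.I * (l : ℂ) + (σ.form f h : ℂ)) • (Y - C)) ∈ (field π h).graph := by
    rw [rh.mem_graph_iff hl, add_smul, sub_add_cancel_left, ← neg_smul]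
    exact h3
  have h5 := rh.inner_graph h4 h4
  rw [inner_smul_left, inner_smul_right] at h5
  simp only [map_mul, map_add, Complex.conj_I, Complex.conj_ofReal] at h5
  have h6 : (2 * Complex.I * l) * ⟪Y - C, Y - C⟫_ℂ = 0 := by linear_combination -h5
  have h7 : Y - C = 0 := by simpa [hl] using h6
  exact sub_eq_zero.mp h7

end Unitary

end Representation

end ResolventAlgebra

end

theorem mainTheorem9 {X : Type*} [AddCommGroup X] [Module ℝ X] (σ : SymplecticForm X)
    {H : Type*} [NormedAddCommGroup H] [InnerProductSpace ℂ H] [CompleteSpace H]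
    -- `π` is not assumed unital; the injectivity hypotheses force it to be.
    (π : ResolventAlg σ →⋆ₙₐ[ℂ] (H →L[ℂ] H)) (f h : X) (hf : f ≠ 0) (hh : h ≠ 0)
    (kerf : LinearMap.ker (π (R σ 1 f) : H →ₗ[ℂ] H) = ⊥)
    (kerh : LinearMap.ker (π (R σ 1 h) : H →ₗ[ℂ] H) = ⊥) :
    -- selfadjointness, and invariance of domains under resolvents
    (IsSelfAdjoint (field π f) ∧
      ∀ l : ℝ, l ≠ 0 → ∀ ψ ∈ (field π h).domain, π (R σ l f) ψ ∈ (field π h).domain) ∧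
    -- the limit `λ → ∞`
    (∀ ψ : H, Filter.Tendsto (fun l : ℝ => (Complex.I * (l : ℂ)) • π (R σ l f) ψ)
      Filter.atTop (nhds ψ)) ∧
    -- the limit `s → 0`
    (∀ ψ : H, Filter.Tendsto (fun s : ℝ => Complex.I • π (R σ 1 (s • f)) ψ)
      (nhdsWithin 0 {0}ᶜ) (nhds ψ)) ∧
    -- the joint dense domain and the canonical commutation relations
    (Dense (jointDomain π f h : Set H) ∧
      ∀ ψ ∈ jointDomain π f h, ∃ (df : ψ ∈ (field π f).domain) (dh : ψ ∈ (field π h).domain)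
        (dfh : field π h ⟨ψ, dh⟩ ∈ (field π f).domain)
        (dhf : field π f ⟨ψ, df⟩ ∈ (field π h).domain),
        field π f ⟨field π h ⟨ψ, dh⟩, dfh⟩ - field π h ⟨field π f ⟨ψ, df⟩, dhf⟩ =
          (Complex.I * (σ.form f h : ℂ)) • ψ) ∧
    -- linearity; the field operator of `l • f + h` is well defined, and `field π 0 = 0`
    (∀ l : ℝ,
      (l • f + h ≠ 0 → LinearMap.ker (π (R σ 1 (l • f + h)) : H →ₗ[ℂ] H) = ⊥) ∧
      ∀ ψ ∈ jointDomain π f h, ∃ (d : ψ ∈ (field π (l • f + h)).domain)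
        (df : ψ ∈ (field π f).domain) (dh : ψ ∈ (field π h).domain),
        field π (l • f + h) ⟨ψ, d⟩ = (l : ℂ) • field π f ⟨ψ, df⟩ + field π h ⟨ψ, dh⟩) ∧
    -- products of a field operator with its own resolvents
    (∀ l : ℝ, l ≠ 0 → ∀ ψ : (field π f).domain,
      ∃ d : π (R σ l f) (ψ : H) ∈ (field π f).domain,
        field π f ⟨π (R σ l f) (ψ : H), d⟩ = π (R σ l f) (field π f ψ) ∧
        π (R σ l f) (field π f ψ) = (Complex.I * (l : ℂ)) • π (R σ l f) (ψ : H) - (ψ : H)) ∧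
    -- commutators of a field operator with resolvents
    (∀ l : ℝ, l ≠ 0 → ∀ ψ : (field π f).domain,
      ∃ d : π (R σ l h) (ψ : H) ∈ (field π f).domain,
        field π f ⟨π (R σ l h) (ψ : H), d⟩ - π (R σ l h) (field π f ψ) =
          (Complex.I * (σ.form f h : ℂ)) • π (R σ l h ^ 2) (ψ : H)) ∧
    -- the unitaries `exp(ij(f))`, `exp(ij(h))` exist
    ((∃! U : ℝ → H →L[ℂ] H, IsUnitaryGroupOf (field π f) U) ∧
      (∃! U : ℝ → H →L[ℂ] H, IsUnitaryGroupOf (field π h) U)) ∧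
    -- the Weyl relations
    (expI (field π f) * expI (field π h) =
      Complex.exp (-(Complex.I * (σ.form f h : ℂ))) • (expI (field π h) * expI (field π f))) ∧
    -- the action on resolvents; the von Neumann series of `R(l + iσ(h,f), h)` converges to the
    -- same element at every admissible centre
    (∀ l : ℝ, l ≠ 0 →
      (∀ μ : ℝ, ‖((l : ℂ) + Complex.I * (σ.form h f : ℂ)) - (μ : ℂ)‖ < |μ| →
        HasSum (neumannTerm σ μ ((l : ℂ) + Complex.I * (σ.form h f : ℂ)) h)
          (complexR σ ((l : ℂ) + Complex.I * (σ.form h f : ℂ)) h)) ∧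
      expI (field π f) * π (R σ l h) * star (expI (field π f)) =
        π (complexR σ ((l : ℂ) + Complex.I * (σ.form h f : ℂ)) h)) ∧
    -- invariance of the joint domain, and the common core
    ((∀ ψ ∈ jointDomain π f h, expI (field π f) ψ ∈ jointDomain π f h) ∧
      (∀ ψ ∈ jointDomain π f h, expI (field π h) ψ ∈ jointDomain π f h) ∧
      (field π f).HasCore (jointDomain π f h) ∧ (field π h).HasCore (jointDomain π f h)) := by
  have rf := isResolventFamily_field π hf kerf
  have rh := isResolventFamily_field π hh kerh
  have hswap := jointDomain_comm π hf hh
  refine ⟨⟨rf.isSelfAdjoint, fun l hl ψ hψ => ?_⟩, fun ψ => ?_, fun ψ => ?_,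
    ⟨dense_jointDomain π hf hh kerf kerh, commutator_field π hf hh kerf kerh⟩,
    fun l => ⟨ker_sum π hf hh kerf kerh l, field_sum π hf hh kerf kerh l⟩, fun l hl ψ => ?_,
    fun l hl ψ => ?_, ⟨rf.existsUnique_isUnitaryGroupOf, rh.existsUnique_isUnitaryGroupOf⟩,
    weyl_relation_field π hf kerf hh kerh,
    fun l hl => ⟨fun μ hμ => hasSum_complexR (by simpa using hl) hh hμ,
      expI_conj_resolvent π hf kerf hh kerh hl⟩,
    fun ψ hψ => expI_mem_jointDomain π hf kerf hh hψ, fun ψ hψ => ?_,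
    hasCore_jointDomain π hf hh kerf kerh, ?_⟩
  · exact LinearPMap.mem_domain_iff.mpr
      ⟨_, mem_graph_commutator π hh kerh hf hl ((field π h).mem_graph ⟨ψ, hψ⟩)⟩
  · exact rf.tendsto_smul_apply Filter.tendsto_abs_atTop_atTop ψ
  · have hu : Filter.Tendsto (fun s : ℝ => |s⁻¹|) (nhdsWithin 0 {0}ᶜ) Filter.atTop :=
      tendsto_norm_inv_nhdsNE_zero_atTop
    refine (rf.tendsto_smul_apply hu ψ).congr' ?_
    filter_upwards [self_mem_nhdsWithin] with s hs
    rw [rep_smul π hs one_ne_zero hf, mul_one, mul_smul, _root_.smul_apply, Complex.ofReal_inv]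
  · have h1 := (rf.mem_graph_iff hl).mp ((field π f).mem_graph ψ)
    rw [map_sub, map_smul] at h1
    have h2 : π (R σ l f) (field π f ψ) =
        (Complex.I * (l : ℂ)) • π (R σ l f) (ψ : H) - (ψ : H) := by
      linear_combination (norm := module) -h1
    obtain ⟨d, e⟩ := exists_apply_eq_of_mem_graph (rf.apply_mem_graph hl (ψ : H))
    exact ⟨d, e.trans h2.symm, h2⟩
  · obtain ⟨d, e⟩ := exists_apply_eq_of_mem_graph
      (mem_graph_commutator π hf kerf hh hl ((field π f).mem_graph ψ))
    refine ⟨d, ?_⟩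
    rw [e, add_sub_cancel_left, pow_two, map_mul]
    rfl
  · rw [hswap] at hψ ⊢
    exact expI_mem_jointDomain π hh kerh hf hψ
  · rw [hswap]
    exact hasCore_jointDomain π hh hf kerh kerf
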